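/- **Theorem.** Write $\mathbb N=\{1,2,\dots\}$, $\mathbb N_0=\mathbb N\cup\{0\}$, and let $\|\cdot\|_1$, $\|\cdot\|_\infty$ be the $1$-norm and the maximum norm on $\mathbb R^n$. Let $d,\mathbf d,\mathbf L,\mathbf J,M,K,N\in\mathbb N$, $\gamma,L\in\mathbb R$, $c\in[\max\{2,L\},\infty)$, $\mathbf l=(\mathbf l_0,\dots,\mathbf l_{\mathbf L})\in\mathbb N^{\mathbf L+1}$ and $\mathbf N\subseteq\{0,\dots,N\}$ satisfy $0\in\mathbf N$, $\mathbf l_0=d$, $\mathbf l_{\mathbf L}=1$ and $\mathbf d\ge\sum_{i=1}^{\mathbf L}\mathbf l_i(\mathbf l_{i-1}+1)$. *Networks.* For $m,n\in\mathbb N$, $s\in\mathbb N_0$, $\theta\in\mathbb R^{\mathbf d}$ with $\mathbf d\ge s+mn+m$ let $\mathcal A^{\theta,s}_{m,n}\colon\mathbb R^n\to\mathbb R^m$ be the affine map whose $i$-th component is $x\mapsto\sum_{j=1}^n\theta_{s+(i-1)n+j}\,x_j+\theta_{s+mn+i}$. For $1\le i<\mathbf L$ let $\mathbf a_i\colon\mathbb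 R^{\mathbf l_i}\to\mathbb R^{\mathbf l_i}$ be the componentwise map $x\mapsto\max\{x,0\}$, let $\mathbf a_{\mathbf L}(x)=\max\{\min\{x,1\},0\}$ for $x\in\mathbb R$, and for $\theta\in\mathbb R^{\mathbf d}$ let $\mathscr N_\theta\colon\mathbb R^d\to\mathbb R$ be $$\mathscr N_\theta=\mathbf a_{\mathbf L}\circ\mathcal A^{\theta,s_{\mathbf L}}_{\mathbf l_{\mathbf L},\mathbf l_{\mathbf L-1}}\circ\mathbf a_{\mathbf L-1}\circ\mathcal A^{\theta,s_{\mathbf L-1}}_{\mathbf l_{\mathbf L-1},\mathbf l_{\mathbf L-2}}\circ\dots\circ\mathbf a_1\circ\mathcal A^{\theta,s_1}_{\mathbf l_1,\mathbf l_0},\qquad s_r=\sum_{i=1}^{r-1}\mathbf l_i(\mathbf l_{i-1}+1).$$ *Data.* Let $(\Omega,\mathcal F,\mathbb P)$ be a probability space, and let $X^{k,n}_j\colon\Omega\to[0,1]^d$ and $Y^{k,n}_j\colon\Omega\to[0,1]$, $k,n,j\in\mathbb N_0$, be functions such that $(X^{0,0}_j,Y^{0,0}_j)$, $j\in\mathbb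 N$, are i.i.d. random variables. Let $\mathcal E\colon[0,1]^d\to[0,1]$ satisfy $\mathcal E(X^{0,0}_1)=\mathbb E[Y^{0,0}_1\mid X^{0,0}_1]$ $\mathbb P$-a.s. and $|\mathcal E(x)-\mathcal E(y)|\le L\|x-y\|_1$ for all $x,y\in[0,1]^d$. For $k,n\in\mathbb N_0$, $J\in\mathbb N$, $\theta\in\mathbb R^{\mathbf d}$, $\omega\in\Omega$ let $$\mathcal R^{k,n}_J(\theta,\omega)=\frac1J\sum_{j=1}^J\bigl|\mathscr N_\theta(X^{k,n}_j(\omega))-Y^{k,n}_j(\omega)\bigr|^2.$$ *Training.* Let $\Theta_{k,n}\colon\Omega\to\mathbb R^{\mathbf d}$, $k,n\in\mathbb N_0$, and $\mathbf k\colon\Omega\to(\mathbb N_0)^2$ be random variables. Assume that $\Theta_{k,0}$, $k\in\mathbb N$, are i.i.d. with values in $[-c,c]^{\mathbf d}$ and that $\Theta_{1,0}$ is uniformly distributed on $[-c,c]^{\mathbf d}$. Let $\mathcal G^{k,n}\colon\mathbb R^{\mathbf d}\times\Omega\to\mathbb R^{\mathbf d}$, $k,n\in\mathbb N$, be functions such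 that $\mathcal G^{k,n}(\theta,\omega)=(\nabla_\theta\mathcal R^{k,n}_{\mathbf J})(\theta,\omega)$ for all $k,n\in\mathbb N$, $\omega\in\Omega$ and all $\theta$ at which $\mathcal R^{k,n}_{\mathbf J}(\cdot,\omega)$ is differentiable. Assume for all $k,n\in\mathbb N$, $\omega\in\Omega$ that $$\Theta_{k,n}(\omega)=\Theta_{k,n-1}(\omega)-\gamma\,\mathcal G^{k,n}(\Theta_{k,n-1}(\omega),\omega)$$ and for all $\omega\in\Omega$ that $$\mathbf k(\omega)\in\operatorname*{arg\,min}_{(l,m)\in\{1,\dots,K\}\times\mathbf N,\ \|\Theta_{l,m}(\omega)\|_\infty\le c}\mathcal R^{0,0}_M(\Theta_{l,m}(\omega),\omega).$$ Then $\Omega\times[0,1]^d\ni(\omega,x)\mapsto|\mathscr N_{\Theta_{\mathbf k(\omega)}(\omega)}(x)-\mathcal E(x)|$ is measurable and $$\mathbb E\Bigl[\int_{[0,1]^d}\bigl|\mathscr N_{\Theta_{\mathbf k}}(x)-\mathcal E(x)\bigr|\,\mathbb P_{X^{0,0}_1}(\mathrm dx)\Bigr]\le\frac{d\,c^3}{[\min\{\mathbf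 L,\mathbf l_1,\dots,\mathbf l_{\mathbf L-1}\}]^{1/d}}+\frac{c^3\,\mathbf L(\|\mathbf l\|_\infty+1)\ln(eM)}{M^{1/4}}+\frac{\mathbf L(\|\mathbf l\|_\infty+1)^{\mathbf L}c^{\mathbf L+1}}{K^{[(2\mathbf L)^{-1}(\|\mathbf l\|_\infty+1)^{-2}]}}.$$ -/

import Mathlib

open MeasureTheory ProbabilityTheory

noncomputable section

/-- The cube `[0,1]^d`. -/
abbrev UnitCube (d : ℕ) : Type := Set.Icc (0 : Fin d → ℝ) 1

/-- The `i`-th entry (counted from `0`) of the parameter vector `θ ∈ ℝ^D`. The value `0` beyond the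
length of `θ` is never used by a network whose number of parameters is at most `D`. -/
def param {D : ℕ} (θ : Fin D → ℝ) (i : ℕ) : ℝ := if h : i < D then θ ⟨i, h⟩ else 0

/-- The affine map `ℝ^n → ℝ^m` whose `m × n` weight matrix, row by row, and then bias vector are
the entries of `θ` that follow the first `s` ones. -/
def affineMap {D : ℕ} (θ : Fin D → ℝ) (s m n : ℕ) (x : Fin n → ℝ) : Fin m → ℝ :=
  fun i => (∑ j : Fin n, param θ (s + (i : ℕ) * n + (j : ℕ)) * x j)
    + param θ (s + m * n + (i : ℕ))

/-- Number of parameters of the first `i` affine maps: `∑_{j=1}^{i} l_j (l_{j-1} + 1)`. -/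
def numParams (l : ℕ → ℕ) (i : ℕ) : ℕ := ∑ j ∈ Finset.Icc 1 i, l j * (l (j - 1) + 1)

/-- The values in the `i`-th layer of a fully connected network with layer dimensions
`l 0, l 1, …`, where every layer is followed by the componentwise rectifier `max{·, 0}`. -/
def hiddenLayer {D : ℕ} (θ : Fin D → ℝ) (l : ℕ → ℕ) :
    (i : ℕ) → (Fin (l 0) → ℝ) → (Fin (l i) → ℝ)
  | 0, x => x
  | i + 1, x => fun r =>
      max (affineMap θ (numParams l i) (l (i + 1)) (l i) (hiddenLayer θ l i x) r) 0

/-- The clipping function `x ↦ max{min{x, 1}, 0}`. -/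
def clip (x : ℝ) : ℝ := max (min x 1) 0

/-- The realisation `ℝ^d → ℝ` of the network with parameter vector `θ`, layer dimensions
`l 0 = d, l 1, …, l (L - 1), 1`, rectifier activation on the hidden layers `1, …, L - 1` and
clipping on the one-dimensional output layer. -/
def clippedNN {D d : ℕ} (L : ℕ) (l : ℕ → ℕ) (h0 : l 0 = d) (θ : Fin D → ℝ) (x : Fin d → ℝ) : ℝ :=
  clip (affineMap θ (numParams l (L - 1)) 1 (l (L - 1))
    (hiddenLayer θ l (L - 1) (fun j => x (Fin.cast h0 j))) 0)

/-- The empirical risk `(1/J) ∑_{j=1}^{J} |N_θ(x_j) - y_j|²`. -/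
def empiricalRisk {D d : ℕ} (L : ℕ) (l : ℕ → ℕ) (h0 : l 0 = d)
    (x : ℕ → UnitCube d) (y : ℕ → unitInterval) (J : ℕ) (θ : Fin D → ℝ) : ℝ :=
  (1 / (J : ℝ)) * ∑ j ∈ Finset.Icc 1 J, |clippedNN L l h0 θ (x j : Fin d → ℝ) - (y j : ℝ)| ^ 2

/-- The gradient, as the vector of partial derivatives (used at points of differentiability). -/
def grad {D : ℕ} (f : (Fin D → ℝ) → ℝ) (θ : Fin D → ℝ) : Fin D → ℝ :=
  fun i => fderiv ℝ f θ (Pi.single i 1)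

/-- `‖l‖_∞ = max{l_0, …, l_L}`. -/
def maxWidth (L : ℕ) (l : ℕ → ℕ) : ℕ := (Finset.range (L + 1)).sup l

/-- `min{L, l_1, …, l_{L-1}}`. -/
def minSize (L : ℕ) (l : ℕ → ℕ) : ℕ :=
  (insert L ((Finset.Ico 1 L).image l)).min' (Finset.insert_nonempty _ _)

end

/-! Write `a`, `b`, `t` for the three terms of the bound: approximation, generalisation and
optimisation. Networks and target take values in `[0, 1]`, so the claim is trivial when `a + b ≥ 1`;
otherwise `a < 1` and `b < 1`, which forces the network and the sample to be large enough for the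
estimates below.

Approximation: a Lipschitz function is nearly the maximum of the cones `E q - c * ‖x - q‖₁` over a
grid of points `q`. A deep network evaluates this maximum one point per layer
(`exists_clippedNN_eq_runningMax`), so `exists_clippedNN_approx` gives `θ₀` in the box `[-c, c]^D`
with uniform error at most `a`.

Generalisation: on the box the network is Lipschitz in its parameters (`abs_clippedNN_sub_le`). A
finite parameter grid and Hoeffding's exponential moment bound give a random variable `S` that
dominates the deviation between empirical and true risk on the whole box, with `2 * E[S] ≤ b ^ 2`
(`exists_uniform_deviation_bound`, `deviation_le_sq`).

Optimisation: the best of `K` uniform initialisations lies within `2 * c * V` of `θ₀` in the entries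
used by the network, and `E[V] ≤ K ^ (-1 / p)` for `p` used parameters
(`exists_closest_initialisation`).

Combination: the selected vector has empirical risk no larger than that of this initialisation, so
its true risk is larger by at most `2 * S`. By `integral_sq_sub_eq_add`, differences of true risks
are differences of squared `L²` distances to `E`. With `Λ` the Lipschitz constant in the parameters
and `u = a + Λ * 2 * c * V`, the squared `L²` error is thus at most `u ^ 2 + 2 * S`, and the `L¹`
error at most `u + b / 2 + S / b`. Expectations give `a + t + b`. -/

lemma numParams_succ (l : ℕ → ℕ) (i : ℕ) :
    numParams l (i + 1) = numParams l i + l (i + 1) * (l i + 1) := by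
  simp [numParams, Finset.sum_Icc_succ_top]

lemma numParams_mono (l : ℕ → ℕ) : Monotone (numParams l) :=
  monotone_nat_of_le_succ fun i => by rw [numParams_succ]; omega

lemma weight_index_lt {m n i j : ℕ} (hi : i < m) (hj : j < n) : i * n + j < m * (n + 1) := by
  nlinarith

lemma bias_index_lt {m n i : ℕ} (hi : i < m) : m * n + i < m * (n + 1) := by
  nlinarith

lemma clip_mem (x : ℝ) : 0 ≤ clip x ∧ clip x ≤ 1 := by
  simp [clip]

lemma clip_of_mem {x : ℝ} (h0 : 0 ≤ x) (h1 : x ≤ 1) : clip x = x := by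
  simp [clip, h0, h1]

lemma abs_clip_sub_clip_le (x y : ℝ) : |clip x - clip y| ≤ |x - y| := by
  unfold clip
  calc |max (min x 1) 0 - max (min y 1) 0| ≤ |min x 1 - min y 1| := by
        simpa using abs_max_sub_max_le_max (min x 1) 0 (min y 1) 0
    _ ≤ |x - y| := by simpa using abs_min_sub_min_le_max x 1 y 1

lemma abs_relu_sub_relu_le (x y : ℝ) : |max x 0 - max y 0| ≤ |x - y| := by
  simpa using abs_max_sub_max_le_max x 0 y 0

lemma clippedNN_mem {D d : ℕ} (L : ℕ) (l : ℕ → ℕ) (h0 : l 0 = d) (θ : Fin D → ℝ)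
    (x : Fin d → ℝ) : 0 ≤ clippedNN L l h0 θ x ∧ clippedNN L l h0 θ x ≤ 1 :=
  clip_mem _

/-! ### Lipschitz dependence of networks on their parameters. -/

section Lipschitz

variable {D : ℕ} {θ θ' : Fin D → ℝ} {s m n : ℕ} {w c B δ Δ : ℝ}

lemma abs_affineMap_le (hc : 0 ≤ c) (hB : 1 ≤ B) (hn : (n : ℝ) ≤ w)
    (hθ : ∀ k < m * (n + 1), |param θ (s + k)| ≤ c) {x : Fin n → ℝ} (hx : ∀ j, |x j| ≤ B)
    (i : Fin m) : |affineMap θ s m n x i| ≤ c * (w + 1) * B := by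
  have h1 : |∑ j : Fin n, param θ (s + (i : ℕ) * n + (j : ℕ)) * x j| ≤ n * (c * B) := by
    refine (Finset.abs_sum_le_sum_abs _ _).trans ?_
    refine (Finset.sum_le_card_nsmul _ _ (c * B) fun j _ => ?_).trans (by simp)
    rw [abs_mul, add_assoc]
    exact mul_le_mul (hθ _ (weight_index_lt i.2 j.2)) (hx j) (abs_nonneg _) hc
  have h2 : |param θ (s + m * n + (i : ℕ))| ≤ c := by
    rw [add_assoc]; exact hθ _ (bias_index_lt i.2)
  have h3 : (n : ℝ) * (c * B) ≤ w * (c * B) := by gcongr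
  have h4 : c * 1 ≤ c * B := by gcongr
  calc _ ≤ _ := abs_add_le _ _
    _ ≤ c * (w + 1) * B := by linarith

lemma abs_affineMap_sub_le (hc : 0 ≤ c) (hB : 1 ≤ B) (hδ : 0 ≤ δ) (hΔ : 0 ≤ Δ) (hn : (n : ℝ) ≤ w)
    (hθ' : ∀ k < m * (n + 1), |param θ' (s + k)| ≤ c)
    (hθθ' : ∀ k < m * (n + 1), |param θ (s + k) - param θ' (s + k)| ≤ Δ)
    {x x' : Fin n → ℝ} (hx : ∀ j, |x j| ≤ B) (hxx' : ∀ j, |x j - x' j| ≤ δ) (i : Fin m) :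
    |affineMap θ s m n x i - affineMap θ' s m n x' i| ≤ c * (w + 1) * δ + (w + 1) * B * Δ := by
  have h1 : |∑ j : Fin n, (param θ (s + (i : ℕ) * n + (j : ℕ)) * x j
      - param θ' (s + (i : ℕ) * n + (j : ℕ)) * x' j)| ≤ n * (c * δ + Δ * B) := by
    refine (Finset.abs_sum_le_sum_abs _ _).trans ?_
    refine (Finset.sum_le_card_nsmul _ _ (c * δ + Δ * B) fun j _ => ?_).trans
      (by simp [mul_add])
    have h := weight_index_lt (n := n) i.2 j.2
    rw [add_assoc]
    set a := param θ (s + ((i : ℕ) * n + (j : ℕ)))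
    set a' := param θ' (s + ((i : ℕ) * n + (j : ℕ)))
    -- With this splitting only the weights of `θ'` and the inputs `x` have to be bounded.
    have e : a * x j - a' * x' j = a' * (x j - x' j) + (a - a') * x j := by ring
    rw [e]
    refine (abs_add_le _ _).trans ?_
    rw [abs_mul, abs_mul]
    exact add_le_add (mul_le_mul (hθ' _ h) (hxx' j) (abs_nonneg _) hc)
      (mul_le_mul (hθθ' _ h) (hx j) (abs_nonneg _) hΔ)
  have h2 : |param θ (s + m * n + (i : ℕ)) - param θ' (s + m * n + (i : ℕ))| ≤ Δ := by
    rw [add_assoc]; exact hθθ' _ (bias_index_lt i.2)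
  have e : affineMap θ s m n x i - affineMap θ' s m n x' i
      = (∑ j : Fin n, (param θ (s + (i : ℕ) * n + (j : ℕ)) * x j
      - param θ' (s + (i : ℕ) * n + (j : ℕ)) * x' j))
      + (param θ (s + m * n + (i : ℕ)) - param θ' (s + m * n + (i : ℕ))) := by
    simp only [affineMap, Finset.sum_sub_distrib]; ring
  rw [e]
  have h3 : (n : ℝ) * (c * δ + Δ * B) ≤ w * (c * δ + Δ * B) := by
    have : 0 ≤ c * δ + Δ * B := by positivity
    gcongr
  have h4 : Δ * 1 ≤ Δ * B := by gcongr
  have h5 : 0 ≤ c * δ := by positivity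
  exact (abs_add_le _ _).trans (by linarith)

variable {l : ℕ → ℕ} {x : Fin (l 0) → ℝ}

/-- Each layer costs a factor `c * (w + 1)`. This factor is at least `1`, so the running bound stays
at least `1` and absorbs the bias. -/
lemma abs_hiddenLayer_le (hc : 1 ≤ c) (i : ℕ) (hw : ∀ j < i, (l j : ℝ) ≤ w)
    (hθ : ∀ k < numParams l i, |param θ k| ≤ c) (hx : ∀ j, |x j| ≤ 1) (r : Fin (l i)) :
    |hiddenLayer θ l i x r| ≤ (c * (w + 1)) ^ i := by
  induction i with
  | zero => simpa [hiddenLayer] using hx r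
  | succ i ih =>
    have ih' := ih (fun j hj => hw j (by omega))
      (fun k hk => hθ k (hk.trans_le (numParams_mono l (Nat.le_succ i))))
    have hw0 : (0 : ℝ) ≤ w := (Nat.cast_nonneg _).trans (hw i (Nat.lt_succ_self i))
    have h1 : 1 ≤ c * (w + 1) := by nlinarith
    have := abs_affineMap_le (θ := θ) (s := numParams l i) (m := l (i + 1)) (by linarith)
      (one_le_pow₀ h1) (hw i (Nat.lt_succ_self i))
      (fun k hk => hθ _ (by rw [numParams_succ]; omega)) ih' r
    calc |hiddenLayer θ l (i + 1) x r|
        ≤ |affineMap θ (numParams l i) (l (i + 1)) (l i) (hiddenLayer θ l i x) r| := by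
          simpa [hiddenLayer] using abs_relu_sub_relu_le
            (affineMap θ (numParams l i) (l (i + 1)) (l i) (hiddenLayer θ l i x) r) 0
      _ ≤ _ := by rw [pow_succ']; exact this

/-- The bound solves the recursion `e (i + 1) = c * (w + 1) * e i + (w + 1) * (c * (w + 1)) ^ i * Δ`
with `e 0 = 0`: an old error is amplified, and the parameter change of the new layer acts on values
bounded by `abs_hiddenLayer_le`. -/
lemma abs_hiddenLayer_sub_le (hc : 1 ≤ c) (hΔ : 0 ≤ Δ) (i : ℕ) (hw : ∀ j < i, (l j : ℝ) ≤ w)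
    (hθ : ∀ k < numParams l i, |param θ k| ≤ c) (hθ' : ∀ k < numParams l i, |param θ' k| ≤ c)
    (hθθ' : ∀ k < numParams l i, |param θ k - param θ' k| ≤ Δ)
    (hx : ∀ j, |x j| ≤ 1) (r : Fin (l i)) :
    |hiddenLayer θ l i x r - hiddenLayer θ' l i x r|
      ≤ i * (w + 1) ^ i * c ^ (i - 1) * Δ := by
  induction i with
  | zero => simp [hiddenLayer]
  | succ i ih =>
    have hi := numParams_mono l (Nat.le_succ i)
    have ih' := ih (fun j hj => hw j (by omega)) (fun k hk => hθ k (hk.trans_le hi))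
      (fun k hk => hθ' k (hk.trans_le hi)) (fun k hk => hθθ' k (hk.trans_le hi))
    have hw0 : (0 : ℝ) ≤ w := (Nat.cast_nonneg _).trans (hw i (Nat.lt_succ_self i))
    have h1 : 1 ≤ c * (w + 1) := by nlinarith
    have hlt : ∀ k < l (i + 1) * (l i + 1), numParams l i + k < numParams l (i + 1) := by
      intro k hk; rw [numParams_succ]; omega
    have := abs_affineMap_sub_le (θ := θ) (θ' := θ') (s := numParams l i) (m := l (i + 1))
      (by linarith) (one_le_pow₀ h1) (by positivity) hΔ (hw i (Nat.lt_succ_self i))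
      (fun k hk => hθ' _ (hlt k hk)) (fun k hk => hθθ' _ (hlt k hk))
      (abs_hiddenLayer_le hc i (fun j hj => hw j (by omega)) (fun k hk => hθ k (hk.trans_le hi)) hx)
      ih' r
    refine (abs_relu_sub_relu_le _ _).trans (this.trans (le_of_eq ?_))
    -- At `i = 0` the exponent `i - 1` is truncated, but the term carries the factor `i = 0`.
    rcases i with _ | i
    · simp
    · simp only [Nat.add_sub_cancel, mul_pow]; push_cast; ring

/-- On a box of side `c ≥ 1`, clipped networks depend on their parameters in a Lipschitz way. -/
theorem abs_clippedNN_sub_le {d L : ℕ} (hL : 1 ≤ L) (hl0 : l 0 = d) (hlL : l L = 1)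
    (hw : ∀ j < L, (l j : ℝ) ≤ w) (hc : 1 ≤ c) (hΔ : 0 ≤ Δ)
    (hθ : ∀ k < numParams l L, |param θ k| ≤ c) (hθ' : ∀ k < numParams l L, |param θ' k| ≤ c)
    (hθθ' : ∀ k < numParams l L, |param θ k - param θ' k| ≤ Δ)
    {x : Fin d → ℝ} (hx : ∀ j, |x j| ≤ 1) :
    |clippedNN L l hl0 θ x - clippedNN L l hl0 θ' x|
      ≤ L * (w + 1) ^ L * c ^ (L - 1) * Δ := by
  obtain ⟨i, rfl⟩ : ∃ i, L = i + 1 := ⟨L - 1, by omega⟩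
  refine (abs_clip_sub_clip_le _ _).trans ?_
  simp only [Nat.add_sub_cancel]
  have hi := numParams_mono l (Nat.le_succ i)
  have hw0 : (0 : ℝ) ≤ w := (Nat.cast_nonneg _).trans (hw i (Nat.lt_succ_self i))
  have h1 : 1 ≤ c * (w + 1) := by nlinarith
  have hlt : ∀ k < 1 * (l i + 1), numParams l i + k < numParams l (i + 1) := by
    intro k hk; rw [numParams_succ, hlL]; omega
  have hx' : ∀ j : Fin (l 0), |x (Fin.cast hl0 j)| ≤ 1 := fun j => hx _
  have := abs_affineMap_sub_le (θ := θ) (θ' := θ') (s := numParams l i) (m := 1)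
    (by linarith) (one_le_pow₀ h1) (by positivity) hΔ (hw i (Nat.lt_succ_self i))
    (fun k hk => hθ' _ (hlt k hk)) (fun k hk => hθθ' _ (hlt k hk))
    (abs_hiddenLayer_le hc i (fun j hj => hw j (by omega))
      (fun k hk => hθ k (hk.trans_le hi)) hx')
    (abs_hiddenLayer_sub_le hc hΔ i (fun j hj => hw j (by omega))
      (fun k hk => hθ k (hk.trans_le hi)) (fun k hk => hθ' k (hk.trans_le hi))
      (fun k hk => hθθ' k (hk.trans_le hi)) hx') 0
  refine this.trans (le_of_eq ?_)
  rcases i with _ | i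
  · simp
  · simp only [Nat.add_sub_cancel, mul_pow]; push_cast; ring

end Lipschitz

/-! ### Joint continuity in parameters and input. -/

lemma continuous_param {D : ℕ} (i : ℕ) : Continuous fun θ : Fin D → ℝ => param θ i := by
  unfold param
  split_ifs
  · exact continuous_apply _
  · exact continuous_const

lemma continuous_hiddenLayer {D : ℕ} (l : ℕ → ℕ) (i : ℕ) :
    Continuous fun p : (Fin D → ℝ) × (Fin (l 0) → ℝ) => hiddenLayer p.1 l i p.2 := by
  induction i with
  | zero => exact continuous_snd
  | succ i ih =>
    refine continuous_pi fun r => Continuous.max ?_ continuous_const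
    exact (continuous_finsetSum _ fun j _ => ((continuous_param _).comp continuous_fst).mul
      ((continuous_apply j).comp ih)).add ((continuous_param _).comp continuous_fst)

theorem continuous_clippedNN {D d : ℕ} (L : ℕ) (l : ℕ → ℕ) (h0 : l 0 = d) :
    Continuous fun p : (Fin D → ℝ) × (Fin d → ℝ) => clippedNN L l h0 p.1 p.2 := by
  have h : Continuous fun p : (Fin D → ℝ) × (Fin d → ℝ) =>
      hiddenLayer p.1 l (L - 1) (fun j => p.2 (Fin.cast h0 j)) :=
    (continuous_hiddenLayer l (L - 1)).comp (continuous_fst.prodMk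
      (continuous_pi fun j => (continuous_apply _).comp continuous_snd))
  refine Continuous.max (Continuous.min ?_ continuous_const) continuous_const
  exact (continuous_finsetSum _ fun j _ => ((continuous_param _).comp continuous_fst).mul
    ((continuous_apply j).comp h)).add ((continuous_param _).comp continuous_fst)

/-! ### Parameter vectors with prescribed weights and biases. -/

/-- Prescribed weights and biases of the first `n` affine maps are realised by a single sequence of
parameters. -/
lemma exists_param_seq (l : ℕ → ℕ) (wt : ℕ → ℕ → ℕ → ℝ) (b : ℕ → ℕ → ℝ) {c : ℝ} (hc : 0 ≤ c)
    (hwt : ∀ i r j, |wt i r j| ≤ c) (hb : ∀ i r, |b i r| ≤ c) (n : ℕ) :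
    ∃ g : ℕ → ℝ, (∀ k, |g k| ≤ c) ∧ ∀ i < n, ∀ r < l (i + 1),
      (∀ j < l i, g (numParams l i + r * l i + j) = wt i r j) ∧
        g (numParams l i + l (i + 1) * l i + r) = b i r := by
  induction n with
  | zero => exact ⟨fun _ => 0, by simpa using hc, by simp⟩
  | succ n ih =>
    obtain ⟨g, hg, hgi⟩ := ih
    -- Beyond the old blocks, the offset is decoded by division with remainder into row and column
    -- of the weight matrix; the remaining offsets address the biases.
    refine ⟨fun k => if k < numParams l n then g k else
      if k - numParams l n < l (n + 1) * l n then
        wt n ((k - numParams l n) / l n) ((k - numParams l n) % l n)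
      else b n (k - numParams l n - l (n + 1) * l n), fun k => ?_, fun i hi r hr => ?_⟩
    · dsimp only
      split_ifs
      exacts [hg k, hwt _ _ _, hb _ _]
    rcases Nat.lt_succ_iff_lt_or_eq.mp hi with hi | rfl
    · have hle : numParams l i + l (i + 1) * (l i + 1) ≤ numParams l n := by
        rw [← numParams_succ]; exact numParams_mono l hi
      refine ⟨fun j hj => ?_, ?_⟩
      · have := weight_index_lt (n := l i) hr hj
        dsimp only
        rw [if_pos (by omega)]
        exact (hgi i hi r hr).1 j hj
      · have := bias_index_lt (n := l i) hr
        dsimp only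
        rw [if_pos (by omega)]
        exact (hgi i hi r hr).2
    · refine ⟨fun j hj => ?_, ?_⟩
      · have h1 : numParams l i + r * l i + j - numParams l i = r * l i + j := by omega
        have h2 : r * l i + j < l (i + 1) * l i := by nlinarith
        have h3 : (r * l i + j) / l i = r := by
          rw [mul_comm, Nat.mul_add_div (by omega), Nat.div_eq_of_lt hj, add_zero]
        have h4 : (r * l i + j) % l i = j := by
          rw [mul_comm, Nat.mul_add_mod, Nat.mod_eq_of_lt hj]
        dsimp only
        rw [if_neg (by omega), h1, if_pos h2, h3, h4]
      · have h1 : numParams l i + l (i + 1) * l i + r - numParams l i = l (i + 1) * l i + r := by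
          omega
        dsimp only
        rw [if_neg (by omega), h1, if_neg (by omega)]
        congr 1; omega

/-- The output dimension is a variable `m` with `m = l (i + 1)` so that the result also applies to
the output layer, whose dimension is the literal `1`. -/
lemma exists_params (l : ℕ → ℕ) (wt : ℕ → ℕ → ℕ → ℝ) (b : ℕ → ℕ → ℝ) {c : ℝ} (hc : 0 ≤ c)
    (hwt : ∀ i r j, |wt i r j| ≤ c) (hb : ∀ i r, |b i r| ≤ c) {n D : ℕ} (hD : numParams l n ≤ D) :
    ∃ θ : Fin D → ℝ, (∀ k, |θ k| ≤ c) ∧ ∀ i < n, ∀ m, m = l (i + 1) →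
      ∀ (r : Fin m) (x : Fin (l i) → ℝ),
      affineMap θ (numParams l i) m (l i) x r = (∑ j : Fin (l i), wt i r j * x j) + b i r := by
  obtain ⟨g, hg, hgi⟩ := exists_param_seq l wt b hc hwt hb n
  refine ⟨fun k => g k, fun k => hg k, fun i hi m hm r x => ?_⟩
  subst hm
  have hle : numParams l i + l (i + 1) * (l i + 1) ≤ D := by
    rw [← numParams_succ]; exact (numParams_mono l hi).trans hD
  have hpar : ∀ k < D, param (fun k : Fin D => g k) k = g k := fun k hk => by simp [param, hk]
  unfold affineMap
  congr 1
  · refine Finset.sum_congr rfl fun j _ => ?_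
    have := weight_index_lt (n := l i) r.2 j.2
    rw [hpar _ (by omega), (hgi i hi r r.2).1 j j.2]
  · have := bias_index_lt (n := l i) r.2
    rw [hpar _ (by omega), (hgi i hi r r.2).2]

/-! ### A network that computes a maximum of cones. -/

/-- `max {0, s_0, …, s_{n-1}}`. -/
noncomputable def runningMax (s : ℕ → ℝ) : ℕ → ℝ
  | 0 => 0
  | n + 1 => max (runningMax s n) (s n)

lemma runningMax_nonneg (s : ℕ → ℝ) (n : ℕ) : 0 ≤ runningMax s n := by
  induction n with
  | zero => exact le_rfl
  | succ n ih => exact ih.trans (le_max_left _ _)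

lemma runningMax_le {s : ℕ → ℝ} {B : ℝ} (hB : 0 ≤ B) (hs : ∀ i, s i ≤ B) (n : ℕ) :
    runningMax s n ≤ B := by
  induction n with
  | zero => exact hB
  | succ n ih => exact max_le ih (hs n)

lemma le_runningMax (s : ℕ → ℝ) {i n : ℕ} (hi : i < n) : s i ≤ runningMax s n := by
  induction n with
  | zero => omega
  | succ n ih =>
    rcases Nat.lt_succ_iff_lt_or_eq.mp hi with hi | rfl
    · exact (ih hi).trans (le_max_left _ _)
    · exact le_max_right _ _

section Chain

variable (d L : ℕ) (lam : ℝ) (q : ℕ → ℕ → ℝ) (y : ℕ → ℝ)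

/-- Weights of the network that computes `max_i (y i - lam * ‖x - q i‖₁)`, one point per layer. -/
noncomputable def chainWeight (i r j : ℕ) : ℝ :=
  if i + 1 = L then (if j = 2 * d then 1 else 0) + (if j = 2 * d + 1 then 1 else 0)
  else if r < d then
    (if j = r then 1 else 0) - (if i = 0 then 0 else if j = r + d then 1 else 0)
  else if r < 2 * d then
    (if i = 0 then 0 else if j = r then 1 else 0) - (if j = r - d then 1 else 0)
  else if i = 0 then 0
  else if r = 2 * d then (if j = 2 * d then 1 else 0) + (if j = 2 * d + 1 then 1 else 0)
  else if r = 2 * d + 1 then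
    -(if j < 2 * d then lam else 0) - (if j = 2 * d then 1 else 0)
      - (if j = 2 * d + 1 then 1 else 0)
  else 0

/-- Biases of the network that computes `max_i (y i - lam * ‖x - q i‖₁)`. -/
noncomputable def chainBias (i r : ℕ) : ℝ :=
  if i + 1 = L then 0
  else if r < d then (if i = 0 then 0 else q (i - 1) r) - q i r
  else if r < 2 * d then q i (r - d) - (if i = 0 then 0 else q (i - 1) (r - d))
  else if i = 0 then 0
  else if r = 2 * d + 1 then y (i - 1) else 0

/-- State of the hidden layer `i + 1`: the positive and negative parts of `x - q i`, and a splitting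
of the maximum over the previous points into two nonnegative parts. -/
noncomputable def chainState (x s : ℕ → ℝ) (i r : ℕ) : ℝ :=
  if r < d then max (x r - q i r) 0
  else if r < 2 * d then max (q i (r - d) - x (r - d)) 0
  else if r = 2 * d then runningMax s (i - 1)
  else if r = 2 * d + 1 then runningMax s i - runningMax s (i - 1)
  else 0

variable {d L lam q y}

lemma abs_chainWeight_le {c : ℝ} (hc : 2 ≤ c) (hlam0 : 0 ≤ lam) (hlam : lam ≤ c) (i r j : ℕ) :
    |chainWeight d L lam i r j| ≤ c := by
  rw [abs_le]
  unfold chainWeight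
  split_ifs <;> first | (exfalso; omega) | constructor <;> linarith

lemma abs_chainBias_le {c : ℝ} (hc : 2 ≤ c) (hq : ∀ i r, q i r ∈ Set.Icc (0 : ℝ) 1)
    (hy : ∀ i, y i ∈ Set.Icc (0 : ℝ) 1) (i r : ℕ) : |chainBias d L q y i r| ≤ c := by
  have h1 := hq i r
  have h2 := hq (i - 1) r
  have h3 := hq i (r - d)
  have h4 := hq (i - 1) (r - d)
  have h5 := hy (i - 1)
  simp only [Set.mem_Icc] at *
  rw [abs_le]
  unfold chainBias
  split_ifs <;> constructor <;> linarith

lemma max_zero_sub_max_zero (a b : ℝ) : max (a - b) 0 - max (b - a) 0 = a - b := by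
  rcases le_total a b with h | h
  · rw [max_eq_right (by linarith), max_eq_left (by linarith)]; ring
  · rw [max_eq_left (by linarith), max_eq_right (by linarith)]; ring

lemma max_zero_add_max_zero (a b : ℝ) : max (a - b) 0 + max (b - a) 0 = |a - b| := by
  rcases le_total a b with h | h
  · rw [max_eq_right (by linarith), max_eq_left (by linarith), abs_of_nonpos (by linarith)]; ring
  · rw [max_eq_left (by linarith), max_eq_right (by linarith), abs_of_nonneg (by linarith)]; ring

lemma sum_chainState (x s : ℕ → ℝ) (i : ℕ) :
    ∑ j ∈ Finset.range (2 * d), chainState d q x s i j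
      = ∑ k ∈ Finset.range d, |x k - q i k| := by
  rw [two_mul, Finset.sum_range_add, ← Finset.sum_add_distrib]
  refine Finset.sum_congr rfl fun k hk => ?_
  rw [Finset.mem_range] at hk
  rw [← max_zero_add_max_zero]
  unfold chainState
  rw [if_pos hk, if_neg (by omega), if_pos (by omega)]
  simp

lemma chain_first_layer (hL : 1 < L) {x s : ℕ → ℝ} (r : ℕ) :
    max ((∑ j ∈ Finset.range d, chainWeight d L lam 0 r j * x j) + chainBias d L q y 0 r) 0
      = chainState d q x s 0 r := by
  have hL' : ¬ (0 + 1 = L) := by omega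
  unfold chainWeight chainBias chainState
  simp only [if_neg hL', if_true, zero_sub, sub_zero, neg_mul, ite_mul, one_mul, zero_mul]
  by_cases h1 : r < d
  · simp [h1, sub_eq_add_neg]
  by_cases h2 : r < 2 * d
  · have : r - d < d := by omega
    simp only [if_neg h1, if_pos h2]
    simp [this]
    ring_nf
  · simp [h1, h2, runningMax]

/-- Differences of positive and negative parts recover `x - q i`, hence `x - q (i + 1)` after a
shift by the bias; their sum recovers `‖x - q i‖₁`, hence `s i`. The two last entries add up to the
current maximum `m`, and the rectifier turns `s i - m` into the increment `max m (s i) - m`. Storing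
old maximum and increment separately makes every step a single affine map followed by a rectifier.
-/
lemma chain_step {i n : ℕ} (hi : i + 2 < L) (hn : 2 * d + 2 ≤ n) {x s : ℕ → ℝ}
    (hs : s i = y i - lam * ∑ k ∈ Finset.range d, |x k - q i k|) (r : ℕ) :
    max ((∑ j ∈ Finset.range n, chainWeight d L lam (i + 1) r j * chainState d q x s i j)
        + chainBias d L q y (i + 1) r) 0
      = chainState d q x s (i + 1) r := by
  have hL' : ¬ (i + 1 + 1 = L) := by omega
  have hi0 : ¬ (i + 1 = 0) := by omega
  set f := chainState d q x s i with hf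
  have hm : f (2 * d) = runningMax s (i - 1) := by
    rw [hf]; unfold chainState
    rw [if_neg (by omega), if_neg (by omega), if_pos rfl]
  have ht : f (2 * d + 1) = runningMax s i - runningMax s (i - 1) := by
    rw [hf]; unfold chainState
    rw [if_neg (by omega), if_neg (by omega), if_neg (by omega), if_pos rfl]
  have hind : ∀ k < n, ∑ j ∈ Finset.range n, (if j = k then (1 : ℝ) else 0) * f j = f k := by
    intro k hk; simp [hk]
  have huv : ∀ k < d, f k - f (k + d) = x k - q i k := by
    intro k hk
    rw [hf]; unfold chainState
    rw [if_pos hk, if_neg (by omega), if_pos (by omega), Nat.add_sub_cancel]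
    exact max_zero_sub_max_zero _ _
  unfold chainWeight chainBias
  simp only [if_neg hL', if_neg hi0, Nat.add_sub_cancel]
  by_cases h1 : r < d
  · simp only [if_pos h1, sub_mul, Finset.sum_sub_distrib]
    rw [hind r (by omega), hind (r + d) (by omega), huv r h1]
    unfold chainState
    rw [if_pos h1]
    congr 1; ring
  by_cases h2 : r < 2 * d
  · simp only [if_neg h1, if_pos h2, sub_mul, Finset.sum_sub_distrib]
    have h := huv (r - d) (by omega)
    rw [show r - d + d = r by omega] at h
    rw [hind r (by omega), hind (r - d) (by omega)]
    unfold chainState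
    rw [if_neg h1, if_pos h2]
    congr 1; linarith
  by_cases h3 : r = 2 * d
  · subst h3
    simp only [if_neg h1, if_neg h2, if_true, add_mul, Finset.sum_add_distrib]
    rw [hind _ (by omega), hind _ (by omega), hm, ht, if_neg (by omega)]
    unfold chainState
    rw [if_neg (by omega), if_neg (by omega), if_pos rfl, Nat.add_sub_cancel]
    rw [max_eq_left] <;> have := runningMax_nonneg s i <;> linarith
  by_cases h4 : r = 2 * d + 1
  · subst h4
    simp only [if_neg h1, if_neg h2, if_neg h3, if_true, sub_mul, Finset.sum_sub_distrib]
    rw [hind _ (by omega), hind _ (by omega), hm, ht]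
    have hsum : ∑ j ∈ Finset.range n, -(if j < 2 * d then lam else 0) * f j
        = -(lam * ∑ k ∈ Finset.range d, |x k - q i k|) := by
      rw [← sum_chainState x s i, Finset.mul_sum, ← Finset.sum_neg_distrib,
        ← Finset.sum_subset (Finset.range_subset_range.mpr (show 2 * d ≤ n by omega))]
      · refine Finset.sum_congr rfl fun j hj => ?_
        rw [if_pos (Finset.mem_range.mp hj)]; ring
      · intro j _ hj
        rw [if_neg (by simpa using hj)]; simp
    rw [hsum]
    unfold chainState
    rw [if_neg (by omega), if_neg (by omega), if_neg (by omega), if_pos rfl, Nat.add_sub_cancel]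
    -- The increment of the running maximum equals `max (s i - runningMax s i) 0`.
    have : runningMax s (i + 1) = max (runningMax s i) (s i) := rfl
    rw [this, hs, ← max_sub_sub_right, sub_self, max_comm]
    congr 1; ring
  · unfold chainState
    simp [h1, h2, h3, h4]

end Chain

/-- A network with at least `n + 2` layers and hidden layers of width at least `2 d + 2` computes the
maximum of `n` cones. -/
theorem exists_clippedNN_eq_runningMax {d D L : ℕ} {l : ℕ → ℕ} (hL : 2 ≤ L) (hl0 : l 0 = d)
    (hlL : l L = 1) (hD : numParams l L ≤ D) (hl : ∀ i, 1 ≤ i → i < L → 2 * d + 2 ≤ l i)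
    {c lam : ℝ} (hc : 2 ≤ c) (hlam0 : 0 ≤ lam) (hlam : lam ≤ c) (q : ℕ → Fin d → ℝ) (y : ℕ → ℝ)
    (hq : ∀ i k, q i k ∈ Set.Icc (0 : ℝ) 1) (hy : ∀ i, y i ∈ Set.Icc (0 : ℝ) 1) :
    ∃ θ : Fin D → ℝ, (∀ k, |θ k| ≤ c) ∧ ∀ x : Fin d → ℝ,
      clippedNN L l hl0 θ x
        = runningMax (fun i => y i - lam * ∑ k, |x k - q i k|) (L - 2) := by
  subst hl0
  set q' : ℕ → ℕ → ℝ := fun i j => if h : j < l 0 then q i ⟨j, h⟩ else 0 with hq'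
  have hq'01 : ∀ i r, q' i r ∈ Set.Icc (0 : ℝ) 1 := by
    intro i r
    simp only [hq']
    split_ifs
    · exact hq _ _
    · simp
  obtain ⟨θ, hθ, hθa⟩ := exists_params l (chainWeight (l 0) L lam) (chainBias (l 0) L q' y)
    (by linarith) (abs_chainWeight_le hc hlam0 hlam) (abs_chainBias_le hc hq'01 hy) hD
  refine ⟨θ, hθ, fun x => ?_⟩
  set x' : ℕ → ℝ := fun j => if h : j < l 0 then x ⟨j, h⟩ else 0 with hx'
  set s : ℕ → ℝ := fun i => y i - lam * ∑ k, |x k - q i k| with hs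
  have hs' : ∀ i, s i = y i - lam * ∑ k ∈ Finset.range (l 0), |x' k - q' i k| := by
    intro i
    simp only [hs]
    rw [← Fin.sum_univ_eq_sum_range (fun k => |x' k - q' i k|)]
    simp [hx', hq']
  have hidden : ∀ i, i + 1 < L → ∀ r : Fin (l (i + 1)),
      hiddenLayer θ l (i + 1) x r = chainState (l 0) q' x' s i r := by
    intro i
    induction i with
    | zero =>
      intro hi r
      simp only [hiddenLayer]
      rw [hθa 0 (by omega) _ rfl r,
        ← chain_first_layer (lam := lam) (y := y) (by omega : 1 < L),
        ← Fin.sum_univ_eq_sum_range (fun j => chainWeight (l 0) L lam 0 r j * x' j)]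
      simp [hx']
    | succ i ih =>
      intro hi r
      change max (affineMap θ _ _ _ (hiddenLayer θ l (i + 1) x) r) 0 = _
      rw [hθa (i + 1) (by omega) _ rfl r,
        ← chain_step (L := L) (by omega) (hl (i + 1) (by omega) (by omega)) (hs' i),
        ← Fin.sum_univ_eq_sum_range
          (fun j => chainWeight (l 0) L lam (i + 1) r j * chainState (l 0) q' x' s i j)]
      simp only [ih (by omega)]
  -- The last hidden layer `L - 1` carries the state with index `L - 2`; the output layer only adds
  -- its two halves of the maximum.
  obtain ⟨i, rfl⟩ : ∃ i, L = i + 2 := ⟨L - 2, by omega⟩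
  have hw := hl (i + 1) (by omega) (by omega)
  have key : affineMap θ (numParams l (i + 1)) 1 (l (i + 1)) (hiddenLayer θ l (i + 1) x) 0
      = runningMax s i := by
    rw [hθa (i + 1) (by omega) 1 hlL.symm 0]
    simp only [hidden i (by omega)]
    rw [Fin.sum_univ_eq_sum_range
      (fun j => chainWeight (l 0) (i + 2) lam (i + 1) ((0 : Fin 1) : ℕ) j
        * chainState (l 0) q' x' s i j)]
    simp only [chainWeight, chainBias, if_true, add_mul, Finset.sum_add_distrib, ite_mul, one_mul,
      zero_mul, Finset.sum_ite_eq', Finset.mem_range]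
    rw [if_pos (by omega), if_pos (by omega)]
    unfold chainState
    rw [if_neg (by omega), if_neg (by omega), if_pos rfl, if_neg (by omega), if_neg (by omega),
      if_neg (by omega), if_pos rfl]
    ring
  change clip (affineMap θ (numParams l (i + 1)) 1 (l (i + 1)) (hiddenLayer θ l (i + 1) x) 0) = _
  rw [key]
  -- Each cone is at most its apex value `y j ≤ 1`, so clipping changes nothing.
  refine clip_of_mem (runningMax_nonneg _ _) (runningMax_le zero_le_one (fun j => ?_) _)
  have h1 := (hy j).2
  have h2 : 0 ≤ lam * ∑ k, |x k - q j k| := by positivity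
  simp only [hs]; linarith

/-! ### Approximation of Lipschitz functions on the cube. -/

lemma exists_grid_near {N : ℕ} (hN : 0 < N) {t : ℝ} (ht : t ∈ Set.Icc (0 : ℝ) 1) :
    ∃ g : Fin N, |t - (2 * (g : ℕ) + 1) / (2 * N)| ≤ 1 / (2 * N) := by
  have hN' : (0 : ℝ) < N := by exact_mod_cast hN
  obtain ⟨h0, h1⟩ := ht
  have key : ∃ g : Fin N, ((g : ℕ) : ℝ) ≤ t * N ∧ t * N ≤ (g : ℕ) + 1 := by
    -- The floor picks the cell of `t`, except at `t = 1`, which is assigned to the last cell.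
    by_cases h : ⌊t * N⌋₊ < N
    · exact ⟨⟨_, h⟩, Nat.floor_le (by positivity), (Nat.lt_floor_add_one _).le⟩
    · have h2 : (N : ℝ) ≤ t * N :=
        (Nat.cast_le.mpr (not_lt.mp h)).trans (Nat.floor_le (by positivity))
      have h3 : ((N - 1 : ℕ) : ℝ) = N - 1 := by rw [Nat.cast_sub hN]; simp
      refine ⟨⟨N - 1, by omega⟩, ?_, ?_⟩
      · simp only [h3]; linarith
      · simp only [h3]; nlinarith
  obtain ⟨g, hg0, hg1⟩ := key
  refine ⟨g, ?_⟩
  have e : t - (2 * (g : ℕ) + 1) / (2 * N) = (2 * (t * N) - (2 * (g : ℕ) + 1)) / (2 * N) := by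
    field_simp
  rw [e, abs_div, abs_of_pos (show (0 : ℝ) < 2 * N by positivity)]
  gcongr
  rw [abs_le]; constructor <;> linarith

lemma minSize_le_depth (L : ℕ) (l : ℕ → ℕ) : minSize L l ≤ L :=
  Finset.min'_le _ _ (Finset.mem_insert_self _ _)

lemma minSize_le_width {L : ℕ} (l : ℕ → ℕ) {i : ℕ} (h1 : 1 ≤ i) (hi : i < L) :
    minSize L l ≤ l i :=
  Finset.min'_le _ _ (Finset.mem_insert_of_mem
    (Finset.mem_image_of_mem _ (Finset.mem_Ico.mpr ⟨h1, hi⟩)))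

/-- Cones over a grid with `N ^ d` points approximate a Lipschitz function on the unit cube. -/
lemma exists_clippedNN_approx_of_grid {d D L N : ℕ} {l : ℕ → ℕ} (hL : 2 ≤ L) (hl0 : l 0 = d)
    (hlL : l L = 1) (hD : numParams l L ≤ D) (hl : ∀ i, 1 ≤ i → i < L → 2 * d + 2 ≤ l i)
    {c : ℝ} (hc : 2 ≤ c) (hN : 0 < N) (hNL : N ^ d ≤ L - 2) (E : UnitCube d → unitInterval)
    (hE : ∀ x y : UnitCube d,
      |(E x : ℝ) - (E y : ℝ)| ≤ c * ∑ i, |(x : Fin d → ℝ) i - (y : Fin d → ℝ) i|) :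
    ∃ θ : Fin D → ℝ, (∀ k, |θ k| ≤ c) ∧ ∀ x : UnitCube d,
      |clippedNN L l hl0 θ (x : Fin d → ℝ) - (E x : ℝ)| ≤ c * d / N := by
  have hN' : (0 : ℝ) < N := by exact_mod_cast hN
  have hpow : 0 < N ^ d := pow_pos hN d
  have hgrid : ∀ f : Fin d → Fin N, (fun k => (2 * ((f k : ℕ) : ℝ) + 1) / (2 * N))
      ∈ Set.Icc (0 : Fin d → ℝ) 1 := by
    refine fun f => ⟨fun k => ?_, fun k => ?_⟩
    · simp only [Pi.zero_apply]; positivity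
    · simp only [Pi.one_apply]
      rw [div_le_one (by positivity)]
      have : ((f k : ℕ) : ℝ) + 1 ≤ N := by exact_mod_cast (f k).2
      linarith
  let pt : (Fin d → Fin N) → UnitCube d := fun f => ⟨_, hgrid f⟩
  -- Reduction modulo `N ^ d` lets surplus layers repeat grid points, which leaves the maximum over
  -- the grid unchanged.
  let q : ℕ → UnitCube d := fun i =>
    pt (finFunctionFinEquiv.symm ⟨i % N ^ d, Nat.mod_lt _ hpow⟩)
  obtain ⟨θ, hθ, hθx⟩ := exists_clippedNN_eq_runningMax hL hl0 hlL hD hl hc (by linarith) le_rfl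
    (fun i => (q i : Fin d → ℝ)) (fun i => (E (q i) : ℝ))
    (fun i k => ⟨(q i).2.1 k, (q i).2.2 k⟩) (fun i => (E (q i)).2)
  refine ⟨θ, hθ, fun x => ?_⟩
  rw [hθx]
  -- The Lipschitz condition puts every cone below `E`. Conversely, the cone at the nearest grid
  -- point loses at most twice `c * d / (2 * N)`: once in the apex value and once along the slope.
  have hup : runningMax (fun i => (E (q i) : ℝ) - c * ∑ k, |(x : Fin d → ℝ) k
      - (q i : Fin d → ℝ) k|) (L - 2) ≤ E x := by
    refine runningMax_le (E x).2.1 (fun i => ?_) _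
    have := (abs_le.mp (hE x (q i))).1
    linarith
  choose g hg using fun k : Fin d =>
    exists_grid_near hN (t := (x : Fin d → ℝ) k) ⟨x.2.1 k, x.2.2 k⟩
  set i : ℕ := ((finFunctionFinEquiv g : Fin (N ^ d)) : ℕ) with hi
  have hiN : i < N ^ d := (finFunctionFinEquiv g).2
  have hq : q i = pt g := by
    simp only [q]
    congr 1
    rw [Equiv.symm_apply_eq]
    ext
    exact Nat.mod_eq_of_lt hiN
  have hdist : ∑ k, |(x : Fin d → ℝ) k - (q i : Fin d → ℝ) k| ≤ d * (1 / (2 * N)) := by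
    rw [hq]
    refine (Finset.sum_le_card_nsmul _ _ (1 / (2 * (N : ℝ))) fun k _ => hg k).trans ?_
    simp
  have hlow := le_runningMax (fun i => (E (q i) : ℝ) - c * ∑ k, |(x : Fin d → ℝ) k
      - (q i : Fin d → ℝ) k|) (show i < L - 2 by omega)
  have hEx := (abs_le.mp (hE x (q i))).2
  have hdist' := mul_le_mul_of_nonneg_left hdist (show 0 ≤ c by linarith)
  have e : c * (d * (1 / (2 * N))) + c * (d * (1 / (2 * N))) = c * d / N := by
    field_simp; ring
  rw [abs_le]
  constructor
  · linarith
  · have : 0 ≤ c * d / N := by positivity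
    linarith

/-- If the bound is below `1`, then `A = minSize L l` satisfies `A ^ (1 / d) > 8 * d`. This makes
the layers wide enough for the cone network and leaves room for a grid with `N ≈ A ^ (1 / d) / 4`
points per axis. -/
theorem exists_clippedNN_approx {d D L : ℕ} {l : ℕ → ℕ} (hd : 1 ≤ d) (hl0 : l 0 = d)
    (hlL : l L = 1) (hD : numParams l L ≤ D) {c : ℝ} (hc : 2 ≤ c) (E : UnitCube d → unitInterval)
    (hE : ∀ x y : UnitCube d,
      |(E x : ℝ) - (E y : ℝ)| ≤ c * ∑ i, |(x : Fin d → ℝ) i - (y : Fin d → ℝ) i|)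
    (hlt : (d : ℝ) * c ^ 3 / (minSize L l : ℝ) ^ (1 / (d : ℝ)) < 1)
    (hpos : 0 < minSize L l) :
    ∃ θ : Fin D → ℝ, (∀ k, |θ k| ≤ c) ∧ ∀ x : UnitCube d,
      |clippedNN L l hl0 θ (x : Fin d → ℝ) - (E x : ℝ)|
        ≤ (d : ℝ) * c ^ 3 / (minSize L l : ℝ) ^ (1 / (d : ℝ)) := by
  set A := minSize L l with hA
  set a : ℝ := (A : ℝ) ^ (1 / (d : ℝ)) with ha
  have hApos : (0 : ℝ) < A := by exact_mod_cast hpos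
  have hd1 : (1 : ℝ) ≤ d := by exact_mod_cast hd
  have ha0 : 0 < a := by positivity
  have hapow : a ^ d = A := by
    rw [ha, one_div, Real.rpow_inv_natCast_pow hApos.le (by omega)]
  have hc3 : (8 : ℝ) ≤ c ^ 3 := by
    calc (8 : ℝ) = 2 ^ 3 := by norm_num
      _ ≤ c ^ 3 := by gcongr
  have ha8 : 8 * (d : ℝ) < a := by
    rw [div_lt_one ha0] at hlt
    nlinarith
  have haA : a ≤ A := by
    rw [← hapow]
    exact le_self_pow₀ (by linarith) (by omega)
  have hA8 : 8 * d ≤ A := by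
    have : 8 * (d : ℝ) ≤ A := by linarith
    exact_mod_cast this
  -- Rounding up gives `N ≤ 3 / 8 * a` because `a > 8`, hence `N ^ d ≤ A - 2`, while `N ≥ a / 4`
  -- bounds the error by `4 * c * d / a`, and `4 * c ≤ c ^ 3`.
  set N := ⌈a / 4⌉₊ with hN
  have hNpos : 0 < N := Nat.ceil_pos.mpr (by positivity)
  have hN1 : a / 4 ≤ N := Nat.le_ceil _
  have hN2 : (N : ℝ) ≤ 3 / 8 * a := by
    have := Nat.ceil_lt_add_one (show 0 ≤ a / 4 by positivity)
    rw [← hN] at this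
    linarith
  have hNd : N ^ d ≤ A - 2 := by
    have h1 : (N : ℝ) ^ d ≤ 3 / 8 * A := by
      calc (N : ℝ) ^ d ≤ (3 / 8 * a) ^ d := by gcongr
        _ = (3 / 8 : ℝ) ^ d * A := by rw [mul_pow, hapow]
        _ ≤ 3 / 8 * A := by
          gcongr
          exact pow_le_of_le_one (by norm_num) (by norm_num) (by omega)
    have h2 : (8 : ℝ) ≤ A := by
      have : 8 ≤ A := by omega
      exact_mod_cast this
    have h3 : ((N ^ d : ℕ) : ℝ) + 2 ≤ A := by push_cast; linarith
    have h4 : N ^ d + 2 ≤ A := by exact_mod_cast h3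
    omega
  have hAL : A ≤ L := minSize_le_depth L l
  obtain ⟨θ, hθ, hθx⟩ := exists_clippedNN_approx_of_grid (N := N) (by omega) hl0 hlL hD
    (fun i h1 hi => by have := minSize_le_width l h1 hi; omega) hc hNpos (by omega) E hE
  refine ⟨θ, hθ, fun x => (hθx x).trans ?_⟩
  have hN0 : (0 : ℝ) < N := by exact_mod_cast hNpos
  rw [div_le_div_iff₀ hN0 ha0]
  have h1 : a ≤ 4 * N := by linarith
  have h2 : 4 * c ≤ c ^ 3 := by
    nlinarith [mul_nonneg (show 0 ≤ c by linarith) (show 0 ≤ c ^ 2 - 4 by nlinarith)]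
  calc c * d * a ≤ c * d * (4 * N) := by gcongr
    _ = d * (4 * c) * N := by ring
    _ ≤ d * c ^ 3 * N := by gcongr

/-! ### Exponential moments and maxima of deviations. -/

lemma sum_Icc_one_eq_sum_range {α : Type*} [AddCommMonoid α] (f : ℕ → α) (M : ℕ) :
    ∑ j ∈ Finset.Icc 1 M, f j = ∑ j ∈ Finset.range M, f (j + 1) := by
  induction M with
  | zero => simp
  | succ M ih => rw [Finset.sum_Icc_succ_top (by omega), Finset.sum_range_succ, ih]

section Deviation

variable {Ω : Type*} [MeasurableSpace Ω] {P : Measure Ω} [IsProbabilityMeasure P]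

/-- Exponential moment of the normalised deviation of an average of independent variables with
values in `[0, 1]`. -/
lemma integral_exp_abs_average_sub_le {Z : ℕ → Ω → ℝ} (hZ : ∀ j, Measurable (Z j))
    (hindep : iIndepFun Z P) (h01 : ∀ j ω, Z j ω ∈ Set.Icc (0 : ℝ) 1) {m : ℝ}
    (hm : ∀ j, ∫ ω, Z j ω ∂P = m) {M : ℕ} (hM : 1 ≤ M) :
    Integrable (fun ω => Real.exp (√M * |1 / (M : ℝ) * ∑ j ∈ Finset.range M, Z j ω - m|)) P ∧
      ∫ ω, Real.exp (√M * |1 / (M : ℝ) * ∑ j ∈ Finset.range M, Z j ω - m|) ∂P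
        ≤ 2 * Real.exp (1 / 8) := by
  have hM0 : (0 : ℝ) < M := by exact_mod_cast hM
  have hsq : √(M : ℝ) * √(M : ℝ) = M := Real.mul_self_sqrt hM0.le
  have hs0 : 0 < √(M : ℝ) := Real.sqrt_pos.mpr hM0
  have hind : iIndepFun (fun j ω => Z j ω - m) P :=
    hindep.comp (fun _ z => z - m) fun _ => measurable_id.sub_const m
  have hsub : ∀ j ∈ Finset.range M,
      HasSubgaussianMGF (fun ω => Z j ω - m) ((‖(1 : ℝ) - 0‖₊ / 2) ^ 2) P := by
    intro j _
    have := hasSubgaussianMGF_of_mem_Icc (μ := P) (hZ j).aemeasurable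
      (Filter.Eventually.of_forall (h01 j))
    rwa [hm j] at this
  have hsum := HasSubgaussianMGF.sum_of_iIndepFun hind hsub
  set T : Ω → ℝ := fun ω => ∑ j ∈ Finset.range M, (Z j ω - m) with hT
  set t : ℝ := (√(M : ℝ))⁻¹ with ht
  have ht2 : t ^ 2 = 1 / M := by
    rw [ht, inv_pow, Real.sq_sqrt hM0.le, one_div]
  -- Hoeffding's lemma gives variance proxy `1 / 4` per summand, hence `M / 4` for `T`; the exponent
  -- is `(M / 4) * u ^ 2 / 2`.
  have hmgf : ∀ u : ℝ, u ^ 2 = 1 / M → ∫ ω, Real.exp (u * T ω) ∂P ≤ Real.exp (1 / 8) := by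
    intro u hu
    refine (hsum.mgf_le u).trans (le_of_eq ?_)
    rw [hu]
    congr 1
    simp only [Finset.sum_const, Finset.card_range]
    push_cast
    simp
    field_simp
    norm_num
  have heq : ∀ ω, √M * |1 / (M : ℝ) * ∑ j ∈ Finset.range M, Z j ω - m| = |t * T ω| := by
    intro ω
    have : t * T ω = √M * (1 / (M : ℝ) * ∑ j ∈ Finset.range M, Z j ω - m) := by
      simp only [hT, ht, Finset.sum_sub_distrib, Finset.sum_const, Finset.card_range, nsmul_eq_mul]
      have h1 : (√(M : ℝ))⁻¹ = √M * (1 / (M : ℝ)) := by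
        field_simp; rw [sq, hsq]
      rw [h1]; field_simp
    rw [this, abs_mul, abs_of_pos hs0]
  have hle : ∀ ω, Real.exp |t * T ω| ≤ Real.exp (t * T ω) + Real.exp (-t * T ω) := by
    intro ω
    rcases abs_cases (t * T ω) with ⟨h, _⟩ | ⟨h, _⟩
    · rw [h]; linarith [Real.exp_pos (-t * T ω)]
    · rw [h, neg_mul]; linarith [Real.exp_pos (t * T ω)]
  have hintegrable := (hsum.integrable_exp_mul t).add (hsum.integrable_exp_mul (-t))
  have hTm : Measurable T := Finset.measurable_sum _ fun j _ => (hZ j).sub_const m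
  simp only [heq]
  have hintegrable' : Integrable (fun ω => Real.exp |t * T ω|) P := by
    refine hintegrable.mono' ((hTm.const_mul t).abs.exp.aestronglyMeasurable)
      (Filter.Eventually.of_forall fun ω => ?_)
    rw [Real.norm_of_nonneg (Real.exp_pos _).le]
    exact hle ω
  refine ⟨hintegrable', (integral_mono hintegrable' hintegrable hle).trans ?_⟩
  simp only [Pi.add_apply]
  rw [integral_add (hsum.integrable_exp_mul t) (hsum.integrable_exp_mul (-t))]
  have h1 := hmgf t ht2
  have h2 := hmgf (-t) (by rw [neg_sq, ht2])
  linarith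

/-- Finitely many variables with a common exponential moment `B` have an integrable common upper
bound with expectation at most `log (n B)`. -/
lemma exists_integrable_bound_of_exp_moment {ι : Type*} [Fintype ι] [Nonempty ι] {F : ι → Ω → ℝ}
    {B : ℝ} (hB0 : 0 < B) (hintegrable : ∀ i, Integrable (fun ω => Real.exp (F i ω)) P)
    (hB : ∀ i, ∫ ω, Real.exp (F i ω) ∂P ≤ B) :
    ∃ S : Ω → ℝ, Integrable S P ∧ (∀ i ω, F i ω ≤ S ω) ∧
      ∫ ω, S ω ∂P ≤ Real.log (Fintype.card ι * B) := by
  have hcard : (0 : ℝ) < Fintype.card ι := by exact_mod_cast Fintype.card_pos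
  set a : ℝ := Fintype.card ι * B with ha
  have ha0 : 0 < a := by positivity
  have hsum : Integrable (fun ω => ∑ i, Real.exp (F i ω)) P :=
    integrable_finsetSum _ fun i _ => hintegrable i
  -- The tangent of `log` at `a` dominates `F i = log (exp (F i))`; it plays the role of Jensen's
  -- inequality for the maximum.
  refine ⟨fun ω => (Real.log a - 1) + a⁻¹ * ∑ i, Real.exp (F i ω),
    (integrable_const _).add (hsum.const_mul _), fun i ω => ?_, ?_⟩
  · have h1 : Real.exp (F i ω) ≤ ∑ i, Real.exp (F i ω) :=
      Finset.single_le_sum (f := fun i => Real.exp (F i ω)) (fun i _ => (Real.exp_pos _).le)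
        (Finset.mem_univ i)
    have h2 := Real.log_le_sub_one_of_pos (show 0 < a⁻¹ * Real.exp (F i ω) by positivity)
    rw [Real.log_mul (by positivity) (by positivity), Real.log_inv, Real.log_exp] at h2
    have h3 : a⁻¹ * Real.exp (F i ω) ≤ a⁻¹ * ∑ i, Real.exp (F i ω) := by gcongr
    linarith
  · rw [integral_add (integrable_const _) (hsum.const_mul _), integral_const_mul,
      integral_finsetSum _ fun i _ => hintegrable i]
    have h1 : ∑ i, ∫ ω, Real.exp (F i ω) ∂P ≤ a :=
      (Finset.sum_le_card_nsmul _ _ B fun i _ => hB i).trans (by simp [ha])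
    have h2 : a⁻¹ * ∑ i, ∫ ω, Real.exp (F i ω) ∂P ≤ a⁻¹ * a := by gcongr
    rw [inv_mul_cancel₀ ha0.ne'] at h2
    simp only [integral_const, probReal_univ, smul_eq_mul, one_mul]
    linarith

end Deviation

/-! ### Uniform deviation of the empirical risk over the parameter box. -/

lemma abs_sq_sub_sq_le {a b y : ℝ} (ha : 0 ≤ a ∧ a ≤ 1) (hb : 0 ≤ b ∧ b ≤ 1)
    (hy : y ∈ Set.Icc (0 : ℝ) 1) : |(a - y) ^ 2 - (b - y) ^ 2| ≤ 2 * |a - b| := by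
  have e : (a - y) ^ 2 - (b - y) ^ 2 = (a + b - 2 * y) * (a - b) := by ring
  rw [e, abs_mul]
  have : |a + b - 2 * y| ≤ 2 := by
    rw [abs_le]; constructor <;> linarith [hy.1, hy.2, ha.1, ha.2, hb.1, hb.2]
  gcongr

/-- A grid of `N ^ p` parameter vectors in `[-c, c]^D` which vanish beyond the first `p` entries. -/
noncomputable def paramGrid (D : ℕ) (c : ℝ) {p N : ℕ} (g : Fin p → Fin N) : Fin D → ℝ :=
  fun k => if h : (k : ℕ) < p then 2 * c * ((2 * (g ⟨k, h⟩ : ℕ) + 1) / (2 * N)) - c else 0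

lemma abs_paramGrid_le {D : ℕ} {c : ℝ} (hc : 0 ≤ c) {p N : ℕ} (g : Fin p → Fin N) (k : Fin D) :
    |paramGrid D c g k| ≤ c := by
  unfold paramGrid
  split_ifs with h
  · have hlt : ((g ⟨k, h⟩ : ℕ) : ℝ) + 1 ≤ N := by exact_mod_cast (g ⟨k, h⟩).2
    have h0 : (0 : ℝ) ≤ (g ⟨k, h⟩ : ℕ) := Nat.cast_nonneg _
    have hN : (0 : ℝ) < 2 * N := by linarith
    have h1 : (2 * ((g ⟨k, h⟩ : ℕ) : ℝ) + 1) / (2 * N) ≤ 1 := by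
      rw [div_le_one hN]; linarith
    have h2 : 0 ≤ (2 * ((g ⟨k, h⟩ : ℕ) : ℝ) + 1) / (2 * N) := by positivity
    rw [abs_le]; constructor <;> nlinarith
  · simpa using hc

lemma abs_param_le {D : ℕ} {θ : Fin D → ℝ} {c : ℝ} (hc : 0 ≤ c) (h : ∀ k, |θ k| ≤ c) (k : ℕ) :
    |param θ k| ≤ c := by
  unfold param
  split_ifs
  · exact h _
  · simpa using hc

lemma exists_paramGrid_near {D p N : ℕ} {c : ℝ} (hc : 0 < c) (hp : p ≤ D) (hN : 0 < N)
    {θ : Fin D → ℝ} (hθ : ∀ k, |θ k| ≤ c) :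
    ∃ g : Fin p → Fin N, ∀ k < p, |param θ k - param (paramGrid D c g) k| ≤ c / N := by
  have key : ∀ k : Fin p, ∃ g : Fin N, |(θ (Fin.castLE hp k) + c) / (2 * c)
      - (2 * (g : ℕ) + 1) / (2 * N)| ≤ 1 / (2 * N) := by
    intro k
    have h := abs_le.mp (hθ (Fin.castLE hp k))
    refine exists_grid_near hN ⟨by apply div_nonneg <;> linarith, ?_⟩
    rw [div_le_one (by positivity)]; linarith
  choose g hg using key
  have hN' : (0 : ℝ) < N := by exact_mod_cast hN
  refine ⟨g, fun k hk => ?_⟩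
  have h := hg ⟨k, hk⟩
  simp only [param, dif_pos (hk.trans_le hp), paramGrid, dif_pos hk]
  have e : θ ⟨k, hk.trans_le hp⟩ - (2 * c * ((2 * (g ⟨k, hk⟩ : ℕ) + 1) / (2 * N)) - c)
      = 2 * c * ((θ (Fin.castLE hp ⟨k, hk⟩) + c) / (2 * c)
        - (2 * (g ⟨k, hk⟩ : ℕ) + 1) / (2 * N)) := by
    have : Fin.castLE hp ⟨k, hk⟩ = ⟨k, hk.trans_le hp⟩ := rfl
    rw [this]; field_simp; ring
  rw [e, abs_mul, abs_of_pos (show 0 < 2 * c by positivity)]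
  calc _ ≤ 2 * c * (1 / (2 * N)) := by gcongr
    _ = c / N := by field_simp

section Risk

variable {d D L : ℕ} {l : ℕ → ℕ} {hl0 : l 0 = d}

lemma abs_le_one_of_mem_unitCube (x : UnitCube d) (j : Fin d) : |(x : Fin d → ℝ) j| ≤ 1 := by
  have h0 : 0 ≤ (x : Fin d → ℝ) j := x.2.1 j
  rw [abs_of_nonneg h0]; exact x.2.2 j

/-- The squared error `(N_θ(x) - y)²`. -/
noncomputable def sqLoss (L : ℕ) (l : ℕ → ℕ) (hl0 : l 0 = d) (θ : Fin D → ℝ)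
    (z : UnitCube d × unitInterval) : ℝ :=
  (clippedNN L l hl0 θ (z.1 : Fin d → ℝ) - (z.2 : ℝ)) ^ 2

lemma measurable_clippedNN_unitCube (θ : Fin D → ℝ) :
    Measurable fun x : UnitCube d => clippedNN L l hl0 θ (x : Fin d → ℝ) :=
  ((continuous_clippedNN L l hl0).comp
    (Continuous.prodMk_right θ)).measurable.comp measurable_subtype_coe

lemma measurable_sqLoss (θ : Fin D → ℝ) : Measurable (sqLoss L l hl0 θ) :=
  (((measurable_clippedNN_unitCube θ).comp measurable_fst).sub
    (measurable_subtype_coe.comp measurable_snd)).pow_const 2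

lemma sqLoss_mem (θ : Fin D → ℝ) (z : UnitCube d × unitInterval) :
    sqLoss L l hl0 θ z ∈ Set.Icc (0 : ℝ) 1 := by
  have h := clippedNN_mem L l hl0 θ (z.1 : Fin d → ℝ)
  have h0 := z.2.2.1
  have h1 := z.2.2.2
  refine ⟨sq_nonneg _, ?_⟩
  unfold sqLoss
  rw [sq_le_one_iff_abs_le_one, abs_le]
  constructor <;> linarith

lemma empiricalRisk_eq (x : ℕ → UnitCube d) (y : ℕ → unitInterval) (J : ℕ) (θ : Fin D → ℝ) :
    empiricalRisk L l hl0 x y J θ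
      = 1 / (J : ℝ) * ∑ j ∈ Finset.range J, sqLoss L l hl0 θ (x (j + 1), y (j + 1)) := by
  simp only [empiricalRisk, sqLoss, sum_Icc_one_eq_sum_range, sq_abs]

variable {Ω : Type*} [MeasurableSpace Ω] {P : Measure Ω} [IsProbabilityMeasure P]

/-- A uniform bound, over the box `[-c, c]^D`, for the deviation of the empirical risk. -/
theorem exists_uniform_deviation_bound (hL : 1 ≤ L) (hlL : l L = 1) (hD : numParams l L ≤ D)
    {w c : ℝ} (hw : ∀ j < L, (l j : ℝ) ≤ w) (hc : 1 ≤ c)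
    {X : ℕ → Ω → UnitCube d} {Y : ℕ → Ω → unitInterval}
    (hmeas : ∀ j, 1 ≤ j → Measurable (fun ω => (X j ω, Y j ω)))
    (hindep : iIndepFun (fun (j : ℕ) ω => (X (j + 1) ω, Y (j + 1) ω)) P)
    (hident : ∀ j, 1 ≤ j →
      IdentDistrib (fun ω => (X j ω, Y j ω)) (fun ω => (X 1 ω, Y 1 ω)) P P)
    {M N : ℕ} (hM : 1 ≤ M) (hN : 0 < N) :
    ∃ S : Ω → ℝ, Integrable S P ∧
      (∀ ω (θ : Fin D → ℝ), (∀ k, |θ k| ≤ c) →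
        |empiricalRisk L l hl0 (fun j => X j ω) (fun j => Y j ω) M θ
          - ∫ ω', sqLoss L l hl0 θ (X 1 ω', Y 1 ω') ∂P| ≤ S ω) ∧
      ∫ ω, S ω ∂P ≤ Real.log ((N : ℝ) ^ numParams l L * (2 * Real.exp (1 / 8))) / √M
        + 4 * (L * (w + 1) ^ L * c ^ (L - 1) * (c / N)) := by
  have hM0 : (0 : ℝ) < M := by exact_mod_cast hM
  have hs0 : 0 < √(M : ℝ) := Real.sqrt_pos.mpr hM0
  have : Nonempty (Fin N) := ⟨⟨0, hN⟩⟩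
  set Λ : ℝ := L * (w + 1) ^ L * c ^ (L - 1) with hΛ
  set R : (Fin D → ℝ) → ℝ := fun θ => ∫ ω', sqLoss L l hl0 θ (X 1 ω', Y 1 ω') ∂P with hR
  set RM : (Fin D → ℝ) → Ω → ℝ :=
    fun θ ω => empiricalRisk L l hl0 (fun j => X j ω) (fun j => Y j ω) M θ with hRM
  have hexp := fun θ : Fin D → ℝ => integral_exp_abs_average_sub_le (P := P)
    (Z := fun j ω => sqLoss L l hl0 θ (X (j + 1) ω, Y (j + 1) ω)) (m := R θ)
    (fun j => (measurable_sqLoss θ).comp (hmeas (j + 1) (by omega)))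
    (hindep.comp (fun _ => sqLoss L l hl0 θ) fun _ => measurable_sqLoss θ)
    (fun j ω => sqLoss_mem θ _)
    (fun j => ((hident (j + 1) (by omega)).comp (measurable_sqLoss θ)).integral_eq) hM
  obtain ⟨S, hSint, hSle, hSbound⟩ := exists_integrable_bound_of_exp_moment (P := P)
    (F := fun (g : Fin (numParams l L) → Fin N) ω =>
      √M * |RM (paramGrid D c g) ω - R (paramGrid D c g)|)
    (B := 2 * Real.exp (1 / 8)) (by positivity)
    (fun g => by simpa only [hRM, empiricalRisk_eq] using (hexp (paramGrid D c g)).1)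
    (fun g => by simpa only [hRM, empiricalRisk_eq] using (hexp (paramGrid D c g)).2)
  have hcard : (Fintype.card (Fin (numParams l L) → Fin N) : ℝ) = (N : ℝ) ^ numParams l L := by
    simp
  rw [hcard] at hSbound
  -- Moving from `θ` to a grid point at distance `c / N` changes the squared loss by at most `2 * Λ
  -- * c / N`; this is paid once for the empirical and once for the true risk.
  refine ⟨fun ω => S ω / √M + 4 * (Λ * (c / N)), (hSint.div_const _).add (integrable_const _),
    fun ω θ hθ => ?_, ?_⟩
  · obtain ⟨g, hg⟩ := exists_paramGrid_near (by linarith) hD hN hθ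
    set θ' := paramGrid D c g
    have hθ' : ∀ k, |θ' k| ≤ c := abs_paramGrid_le (by linarith) g
    have hnn : ∀ z, |sqLoss L l hl0 θ z - sqLoss L l hl0 θ' z| ≤ 2 * (Λ * (c / N)) := by
      intro z
      refine (abs_sq_sub_sq_le (clippedNN_mem ..) (clippedNN_mem ..) z.2.2).trans ?_
      have := abs_clippedNN_sub_le hL hl0 hlL hw hc (by positivity)
        (fun k _ => abs_param_le (by linarith) hθ k)
        (fun k _ => abs_param_le (by linarith) hθ' k) hg (abs_le_one_of_mem_unitCube z.1)
      linarith
    have h1 : |RM θ ω - RM θ' ω| ≤ 2 * (Λ * (c / N)) := by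
      simp only [hRM, empiricalRisk_eq]
      rw [← mul_sub, ← Finset.sum_sub_distrib, abs_mul, abs_of_pos (by positivity)]
      have : |∑ j ∈ Finset.range M, (sqLoss L l hl0 θ (X (j + 1) ω, Y (j + 1) ω)
          - sqLoss L l hl0 θ' (X (j + 1) ω, Y (j + 1) ω))| ≤ M * (2 * (Λ * (c / N))) := by
        refine (Finset.abs_sum_le_sum_abs _ _).trans ?_
        refine (Finset.sum_le_card_nsmul _ _ (2 * (Λ * (c / N))) fun j _ => hnn _).trans ?_
        simp
      calc _ ≤ 1 / (M : ℝ) * (M * (2 * (Λ * (c / N)))) := by gcongr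
        _ = _ := by field_simp
    have hintegrable : ∀ θ : Fin D → ℝ, Integrable (fun ω' => sqLoss L l hl0 θ (X 1 ω', Y 1 ω')) P :=
      fun θ => Integrable.of_mem_Icc 0 1
        ((measurable_sqLoss θ).comp (hmeas 1 le_rfl)).aemeasurable
        (Filter.Eventually.of_forall fun ω => sqLoss_mem θ _)
    have h2 : |R θ' - R θ| ≤ 2 * (Λ * (c / N)) := by
      simp only [hR]
      rw [← integral_sub (hintegrable θ') (hintegrable θ), ← Real.norm_eq_abs]
      refine (norm_integral_le_of_norm_le_const (C := 2 * (Λ * (c / N)))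
        (Filter.Eventually.of_forall fun ω => ?_)).trans (by simp)
      rw [Real.norm_eq_abs, abs_sub_comm]
      exact hnn _
    have h3 : |RM θ' ω - R θ'| ≤ S ω / √M := by
      rw [le_div_iff₀ hs0, mul_comm]; exact hSle g ω
    have e : RM θ ω - R θ = (RM θ ω - RM θ' ω) + (RM θ' ω - R θ') + (R θ' - R θ) := by ring
    change |RM θ ω - R θ| ≤ _
    rw [e]
    refine (abs_add_three _ _ _).trans ?_
    linarith
  · rw [integral_add (hSint.div_const _) (integrable_const _), integral_div]
    simp only [integral_const, probReal_univ, smul_eq_mul, one_mul]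
    gcongr

end Risk

/-! ### The best of `K` uniform initialisations. -/

section Initialisation

variable {D p : ℕ}

/-- Maximal distance of the first `p` entries of two parameter vectors. -/
noncomputable def headDist (hp : p ≤ D) (θ₀ θ : Fin D → ℝ) : ℝ :=
  ‖fun i : Fin p => θ (Fin.castLE hp i) - θ₀ (Fin.castLE hp i)‖

lemma continuous_headDist (hp : p ≤ D) (θ₀ : Fin D → ℝ) : Continuous (headDist hp θ₀) :=
  (continuous_pi fun _ => (continuous_apply _).sub continuous_const).norm

lemma abs_param_sub_le_headDist (hp : p ≤ D) (θ₀ θ : Fin D → ℝ) {k : ℕ} (hk : k < p) :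
    |param θ k - param θ₀ k| ≤ headDist hp θ₀ θ := by
  simp only [param, dif_pos (hk.trans_le hp)]
  exact norm_le_pi_norm (fun i : Fin p => θ (Fin.castLE hp i) - θ₀ (Fin.castLE hp i)) ⟨k, hk⟩

lemma headDist_le (hp : p ≤ D) {θ₀ θ : Fin D → ℝ} {c : ℝ} (hc : 0 ≤ c)
    (h₀ : ∀ k, |θ₀ k| ≤ c) (h : ∀ k, |θ k| ≤ c) : headDist hp θ₀ θ ≤ 2 * c := by
  refine (pi_norm_le_iff_of_nonneg (by positivity)).mpr fun i => ?_
  refine (abs_sub _ _).trans ?_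
  linarith [h (Fin.castLE hp i), h₀ (Fin.castLE hp i)]

variable {Ω : Type*} [MeasurableSpace Ω] {P : Measure Ω}

/-- A uniformly distributed vector is close to a given vector with at least the probability given by
the volume of a corner cube. -/
lemma pow_le_measure_headDist_le (hp : p ≤ D) {c : ℝ} (hc : 0 < c) {θ₀ : Fin D → ℝ}
    (h₀ : ∀ k, |θ₀ k| ≤ c) {T : Ω → Fin D → ℝ}
    (hT : pdf.IsUniform T (Set.Icc (fun _ => -c) (fun _ => c)) P volume)
    {τ : ℝ} (h0 : 0 ≤ τ) (h1 : τ ≤ 1) :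
    τ ^ p ≤ P.real (T ⁻¹' {θ | headDist hp θ₀ θ ≤ 2 * c * τ}) := by
  set box : Set (Fin D → ℝ) := Set.Icc (fun _ => -c) (fun _ => c) with hbox
  set A : Set (Fin D → ℝ) := {θ | headDist hp θ₀ θ ≤ 2 * c * τ} with hA
  have hAm : MeasurableSet A :=
    (isClosed_le (continuous_headDist hp θ₀) continuous_const).measurableSet
  have hvol : volume.real box = (2 * c) ^ D := by
    rw [measureReal_def, Real.volume_Icc_pi_toReal (fun _ => by linarith)]
    simp only [Finset.prod_const, Finset.card_univ, Fintype.card_fin]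
    congr 1; ring
  have hvolpos : 0 < volume.real box := by rw [hvol]; positivity
  have hns : volume box ≠ 0 := fun h => by
    rw [measureReal_def, h] at hvolpos; simp at hvolpos
  have hnt : volume box ≠ ⊤ := fun h => by
    rw [measureReal_def, h] at hvolpos; simp at hvolpos
  have hP : P.real (T ⁻¹' A) = volume.real (box ∩ A) / volume.real box := by
    rw [measureReal_def, hT.measure_preimage hns hnt hAm, ENNReal.toReal_div]; rfl
  rw [hP, le_div_iff₀ hvolpos, hvol]
  set a : Fin D → ℝ := fun i => if (i : ℕ) < p then max (-c) (θ₀ i - 2 * c * τ) else -c with ha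
  set b : Fin D → ℝ := fun i => if (i : ℕ) < p then min c (θ₀ i + 2 * c * τ) else c with hb
  have hcτ : 0 ≤ c * τ := by positivity
  have hcτ' : c * τ ≤ c := mul_le_of_le_one_right hc.le h1
  have hsub : Set.Icc a b ⊆ box ∩ A := by
    rintro θ ⟨hθa, hθb⟩
    refine ⟨⟨fun i => ?_, fun i => ?_⟩, ?_⟩
    · refine le_trans ?_ (hθa i)
      simp only [ha]; split_ifs
      exacts [le_max_left _ _, le_rfl]
    · refine le_trans (hθb i) ?_
      simp only [hb]; split_ifs
      exacts [min_le_left _ _, le_rfl]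
    · refine (pi_norm_le_iff_of_nonneg (by positivity)).mpr fun i => ?_
      have h2 := hθa (Fin.castLE hp i)
      have h3 := hθb (Fin.castLE hp i)
      have hi : ((Fin.castLE hp i : Fin D) : ℕ) < p := i.2
      simp only [ha, hb, if_pos hi] at h2 h3
      have h4 := (le_max_right _ _).trans h2
      have h5 := h3.trans (min_le_right _ _)
      rw [Real.norm_eq_abs, abs_le]; constructor <;> linarith
  -- For `τ ≤ 1` an interval of radius `2 * c * τ` around a point of `[-c, c]` keeps at least half
  -- of its length inside `[-c, c]`, even at an endpoint.
  have hside : ∀ i : Fin D, 2 * c * (if (i : ℕ) < p then τ else 1) ≤ b i - a i := by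
    intro i
    have := abs_le.mp (h₀ i)
    simp only [ha, hb]
    split_ifs
    · rcases max_cases (-c) (θ₀ i - 2 * c * τ) with ⟨h, _⟩ | ⟨h, _⟩ <;>
      rcases min_cases c (θ₀ i + 2 * c * τ) with ⟨h', _⟩ | ⟨h', _⟩ <;> rw [h, h'] <;> linarith
    · linarith
  have hnn : ∀ i : Fin D, 0 ≤ 2 * c * (if (i : ℕ) < p then τ else 1) := by
    intro i; split_ifs <;> linarith
  have hab : a ≤ b := fun i => by linarith [hside i, hnn i]
  calc τ ^ p * (2 * c) ^ D
      ≤ ∏ i : Fin D, 2 * c * (if (i : ℕ) < p then τ else 1) := by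
        rw [Finset.prod_mul_distrib, Finset.prod_const, Finset.card_univ, Fintype.card_fin,
          Finset.prod_ite, Finset.prod_const, Finset.prod_const_one, mul_one, mul_comm]
        gcongr ?_ * ?_
        refine pow_le_pow_of_le_one h0 h1 ?_
        have : (Finset.univ.filter fun i : Fin D => (i : ℕ) < p).card
            ≤ (Finset.range p).card :=
          Finset.card_le_card_of_injOn (fun i => (i : ℕ)) (fun i hi => by simpa using hi)
            (fun i _ j _ h => Fin.ext h)
        simpa using this
    _ ≤ ∏ i : Fin D, (b i - a i) := Finset.prod_le_prod (fun i _ => hnn i) fun i _ => hside i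
    _ = volume.real (Set.Icc a b) := by
        rw [measureReal_def, Real.volume_Icc_pi_toReal hab]
    _ ≤ volume.real (box ∩ A) :=
        measureReal_mono hsub (measure_ne_top_of_subset Set.inter_subset_left hnt)

variable [IsProbabilityMeasure P]

/-- Among `K` independent uniform initialisations, the best one is close to any given vector. -/
theorem exists_closest_initialisation (hp : p ≤ D) (hp1 : 1 ≤ p) {c : ℝ} (hc : 0 < c)
    {θ₀ : Fin D → ℝ} (h₀ : ∀ k, |θ₀ k| ≤ c) {T : ℕ → Ω → Fin D → ℝ}
    (hmeas : ∀ k, Measurable (T k)) (hrange : ∀ k ω i, |T k ω i| ≤ c) (hindep : iIndepFun T P)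
    (hident : ∀ k, IdentDistrib (T k) (T 0) P P)
    (hunif : pdf.IsUniform (T 0) (Set.Icc (fun _ => -c) (fun _ => c)) P volume)
    {K : ℕ} (hK : 1 ≤ K) :
    ∃ V : Ω → ℝ, Integrable V P ∧ (∀ ω, 0 ≤ V ω) ∧
      (∀ ω, ∃ k < K, ∀ i < p, |param (T k ω) i - param θ₀ i| ≤ 2 * c * V ω) ∧
      ∫ ω, V ω ∂P ≤ (K : ℝ) ^ (-(1 / (p : ℝ))) := by
  have hne : (Finset.range K).Nonempty := ⟨0, Finset.mem_range.mpr hK⟩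
  have h2c : 0 < 2 * c := by positivity
  set v : (Fin D → ℝ) → ℝ := fun θ => headDist hp θ₀ θ / (2 * c) with hv
  have hvm : Measurable v := (continuous_headDist hp θ₀).measurable.div_const _
  set V : Ω → ℝ := fun ω => (Finset.range K).inf' hne fun k => v (T k ω) with hV
  have hVm : Measurable V := by
    refine measurable_of_Ioi fun t => ?_
    have : V ⁻¹' Set.Ioi t = ⋂ k ∈ Finset.range K, T k ⁻¹' (v ⁻¹' Set.Ioi t) := by
      ext ω; simp [hV, Finset.lt_inf'_iff]
    rw [this]
    exact Finset.measurableSet_biInter _ fun k _ => hmeas k (hvm measurableSet_Ioi)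
  have hv0 : ∀ θ, 0 ≤ v θ := fun θ => div_nonneg (norm_nonneg _) h2c.le
  have hV0 : ∀ ω, 0 ≤ V ω := fun ω => Finset.le_inf' _ _ fun k _ => hv0 _
  have hV1 : ∀ ω, V ω ≤ 1 := fun ω => by
    refine (Finset.inf'_le _ (Finset.mem_range.mpr hK)).trans ?_
    rw [hv, div_le_one h2c]
    exact headDist_le hp hc.le h₀ (hrange 0 ω)
  have hVint : Integrable V P := Integrable.of_mem_Icc 0 1 hVm.aemeasurable
    (Filter.Eventually.of_forall fun ω => ⟨hV0 ω, hV1 ω⟩)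
  have hUint : Integrable (fun ω => V ω ^ p) P :=
    Integrable.of_mem_Icc 0 1 (hVm.pow_const p).aemeasurable
      (Filter.Eventually.of_forall fun ω => ⟨pow_nonneg (hV0 ω) p, pow_le_one₀ (hV0 ω) (hV1 ω)⟩)
  have htail : ∀ τ : ℝ, 0 ≤ τ → τ ≤ 1 → P.real {ω | τ < V ω} ≤ (1 - τ ^ p) ^ K := by
    intro τ h0 h1
    set A : Set (Fin D → ℝ) := {θ | τ < v θ} with hA
    have hAm : MeasurableSet A := measurableSet_lt measurable_const hvm
    have hset : {ω | τ < V ω} = ⋂ k ∈ Finset.range K, T k ⁻¹' A := by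
      ext ω; simp [hV, hA, Finset.lt_inf'_iff]
    have hprod : P {ω | τ < V ω} = ∏ k ∈ Finset.range K, P (T k ⁻¹' A) := by
      rw [hset]
      exact hindep.measure_inter_preimage_eq_mul (Finset.range K) fun _ _ => hAm
    have hone : P.real (T 0 ⁻¹' A) ≤ 1 - τ ^ p := by
      have hpow := pow_le_measure_headDist_le hp hc h₀ hunif h0 h1
      have hcompl : T 0 ⁻¹' {θ | headDist hp θ₀ θ ≤ 2 * c * τ} = (T 0 ⁻¹' A)ᶜ := by
        ext ω
        simp only [hA, hv, Set.mem_preimage, Set.mem_ofPred_eq, Set.mem_compl_iff, not_lt]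
        rw [div_le_iff₀ h2c, mul_comm τ]
      rw [hcompl, probReal_compl_eq_one_sub (hmeas 0 hAm)] at hpow
      linarith
    rw [measureReal_def, hprod, ENNReal.toReal_prod]
    calc ∏ k ∈ Finset.range K, (P (T k ⁻¹' A)).toReal
        = ∏ k ∈ Finset.range K, P.real (T 0 ⁻¹' A) :=
          Finset.prod_congr rfl fun k _ => by
            rw [(hident k).measure_preimage_eq hAm, measureReal_def]
      _ = P.real (T 0 ⁻¹' A) ^ K := by simp
      _ ≤ (1 - τ ^ p) ^ K := by gcongr
  have hp0 : p ≠ 0 := by omega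
  -- For the power `V ^ p` the tail bound becomes `(1 - t) ^ K`, whose integral over `[0, 1]` is
  -- explicit.
  have hU : ∫ ω, V ω ^ p ∂P ≤ 1 / (K + 1) := by
    rw [hUint.integral_eq_integral_meas_lt
      (Filter.Eventually.of_forall fun ω => pow_nonneg (hV0 ω) p)]
    have hle : ∀ t ∈ Set.Ioi (0 : ℝ), P.real {ω | t < V ω ^ p}
        ≤ (Set.Ioc (0 : ℝ) 1).indicator (fun t => (1 - t) ^ K) t := by
      intro t ht
      rw [Set.mem_Ioi] at ht
      by_cases h1 : t ≤ 1
      · rw [Set.indicator_of_mem (show t ∈ Set.Ioc (0 : ℝ) 1 from ⟨ht, h1⟩)]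
        have hpow : (t ^ (1 / (p : ℝ))) ^ p = t := by
          rw [one_div, Real.rpow_inv_natCast_pow ht.le hp0]
        have h := htail (t ^ (1 / (p : ℝ))) (by positivity)
          (Real.rpow_le_one ht.le h1 (by positivity))
        rw [hpow] at h
        refine le_trans (measureReal_mono fun ω hω => ?_) h
        refine lt_of_pow_lt_pow_left₀ p (hV0 ω) ?_
        rw [hpow]; exact hω
      · have : {ω | t < V ω ^ p} = ∅ := by
          ext ω
          have := pow_le_one₀ (n := p) (hV0 ω) (hV1 ω)
          simp only [Set.mem_ofPred_eq, Set.mem_empty_iff_false, iff_false, not_lt]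
          linarith
        rw [this, Set.indicator_of_notMem (fun h => h1 h.2)]
        simp
    have hcont : Continuous fun t : ℝ => (1 - t) ^ K := by fun_prop
    have hind : Integrable ((Set.Ioc (0 : ℝ) 1).indicator fun t => (1 - t) ^ K) volume :=
      (hcont.integrableOn_Ioc).integrable_indicator measurableSet_Ioc
    calc _ ≤ ∫ t in Set.Ioi (0 : ℝ), (Set.Ioc (0 : ℝ) 1).indicator (fun t => (1 - t) ^ K) t := by
          refine integral_mono_of_nonneg (Filter.Eventually.of_forall fun t => measureReal_nonneg)
            hind.restrict ?_
          filter_upwards [ae_restrict_mem measurableSet_Ioi] with t ht using hle t ht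
      _ = ∫ t in (0 : ℝ)..1, (1 - t) ^ K := by
          rw [setIntegral_indicator measurableSet_Ioc, intervalIntegral.integral_of_le zero_le_one,
            Set.inter_eq_self_of_subset_right Set.Ioc_subset_Ioi_self]
      _ = 1 / (K + 1) := by
          rw [intervalIntegral.integral_comp_sub_left (fun t => t ^ K)]
          simp [integral_pow]
  refine ⟨V, hVint, hV0, fun ω => ?_, ?_⟩
  · obtain ⟨k, hk, hkV⟩ := Finset.exists_mem_eq_inf' hne fun k => v (T k ω)
    refine ⟨k, Finset.mem_range.mp hk, fun i hi => ?_⟩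
    have : V ω = v (T k ω) := hkV
    rw [this, hv, mul_div_cancel₀ _ h2c.ne']
    exact abs_param_sub_le_headDist hp θ₀ _ hi
  · have hK0 : (0 : ℝ) < K := by exact_mod_cast hK
    set ρ : ℝ := (K : ℝ) ^ (-(1 / (p : ℝ))) with hρ
    have hρ0 : 0 < ρ := by positivity
    have hρp : ρ ^ p = 1 / K := by
      rw [hρ, Real.rpow_neg hK0.le, inv_pow, one_div, Real.rpow_inv_natCast_pow hK0.le hp0, one_div]
    -- Bernoulli's inequality for `V / ρ` is the tangent bound of the concave `p`-th root at `1 / K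
    -- = ρ ^ p`, so taking expectations replaces Jensen's inequality.
    have hbern : ∀ ω, V ω ≤ ρ * (1 - 1 / p) + ρ * (K / p) * V ω ^ p := by
      intro ω
      have h := one_add_mul_le_pow (a := V ω / ρ - 1) (by
        have := div_nonneg (hV0 ω) hρ0.le
        linarith) p
      rw [add_sub_cancel, div_pow, hρp] at h
      have hp' : (0 : ℝ) < p := by exact_mod_cast hp1
      have e : V ω = ρ * (1 - 1 / p) + ρ * (1 / p) * (1 + p * (V ω / ρ - 1)) := by
        field_simp; ring
      calc V ω = _ := e
        _ ≤ ρ * (1 - 1 / p) + ρ * (1 / p) * (V ω ^ p / (1 / K)) := by gcongr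
        _ = _ := by field_simp
    calc ∫ ω, V ω ∂P ≤ ∫ ω, (ρ * (1 - 1 / p) + ρ * (K / p) * V ω ^ p) ∂P :=
          integral_mono hVint ((integrable_const _).add (hUint.const_mul _)) hbern
      _ = ρ * (1 - 1 / p) + ρ * (K / p) * ∫ ω, V ω ^ p ∂P := by
          rw [integral_add (integrable_const _) (hUint.const_mul _), integral_const_mul _
            fun ω => V ω ^ p]
          simp
      _ ≤ ρ * (1 - 1 / p) + ρ * (K / p) * (1 / K) := by
          gcongr
          refine hU.trans ?_
          gcongr
          linarith
      _ = ρ := by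
          field_simp; ring

end Initialisation

/-! ### Bias-variance decomposition and Jensen's inequality for the square. -/

section BiasVariance

variable {Ω α : Type*} [MeasurableSpace Ω] [mα : MeasurableSpace α] {P : Measure Ω}
  [IsProbabilityMeasure P]

/-- The excess squared risk over the conditional expectation is the squared distance to it. -/
lemma integral_sq_sub_eq_add {X : Ω → α} {Y : Ω → ℝ} (hX : Measurable X) (hY : Measurable Y)
    (hY01 : ∀ ω, Y ω ∈ Set.Icc (0 : ℝ) 1) {e f : α → ℝ} (he : Measurable e) (hf : Measurable f)
    (he01 : ∀ x, e x ∈ Set.Icc (0 : ℝ) 1) (hf01 : ∀ x, f x ∈ Set.Icc (0 : ℝ) 1)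
    (hcond : (fun ω => e (X ω)) =ᵐ[P] P[Y | MeasurableSpace.comap X mα]) :
    ∫ ω, (f (X ω) - Y ω) ^ 2 ∂P
      = ∫ ω, (f (X ω) - e (X ω)) ^ 2 ∂P + ∫ ω, (e (X ω) - Y ω) ^ 2 ∂P := by
  have hm : MeasurableSpace.comap X mα ≤ (inferInstance : MeasurableSpace Ω) := hX.comap_le
  have heX := he.comp hX
  have hfX := hf.comp hX
  have hfe : ∀ x, |f x - e x| ≤ 1 := fun x => by
    have h1 := hf01 x
    have h2 := he01 x
    rw [abs_le]; constructor <;> linarith [h1.1, h1.2, h2.1, h2.2]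
  have heY : ∀ ω, |e (X ω) - Y ω| ≤ 1 := fun ω => by
    have h1 := he01 (X ω)
    have h2 := hY01 ω
    rw [abs_le]; constructor <;> linarith [h1.1, h1.2, h2.1, h2.2]
  have hbdd : ∀ {g : Ω → ℝ}, Measurable g → (∀ ω, |g ω| ≤ 1) → Integrable g P :=
    fun hg h => Integrable.of_bound hg.aestronglyMeasurable 1 (Filter.Eventually.of_forall h)
  have hYint : Integrable Y P := hbdd hY fun ω => by
    rw [abs_of_nonneg (hY01 ω).1]; exact (hY01 ω).2
  have hh : StronglyMeasurable[MeasurableSpace.comap X mα] fun ω => f (X ω) - e (X ω) :=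
    ((hf.sub he).comp (comap_measurable X)).stronglyMeasurable
  have hpull := condExp_stronglyMeasurable_mul_of_bound hm hh hYint 1
    (Filter.Eventually.of_forall fun ω => hfe (X ω))
  have hint1 : Integrable (fun ω => (f (X ω) - e (X ω)) * Y ω) P :=
    hbdd ((hfX.sub heX).mul hY) fun ω => by
      rw [abs_mul, abs_of_nonneg (hY01 ω).1]
      exact mul_le_one₀ (hfe _) (hY01 ω).1 (hY01 ω).2
  have hint2 : Integrable (fun ω => (f (X ω) - e (X ω)) * e (X ω)) P :=
    hbdd ((hfX.sub heX).mul heX) fun ω => by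
      rw [abs_mul, abs_of_nonneg (he01 _).1]
      exact mul_le_one₀ (hfe _) (he01 _).1 (he01 _).2
  -- The factor `f (X ω) - e (X ω)` is measurable for the σ-algebra of `X`, so it can be pulled out
  -- of the conditional expectation of `Y`; the cross term vanishes.
  have hcross : ∫ ω, (f (X ω) - e (X ω)) * Y ω ∂P = ∫ ω, (f (X ω) - e (X ω)) * e (X ω) ∂P := by
    rw [← integral_condExp hm]
    refine integral_congr_ae ?_
    filter_upwards [hpull, hcond] with ω h1 h2
    calc _ = _ := h1
      _ = _ := by rw [Pi.mul_apply, ← h2]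
  have hint3 : Integrable (fun ω => (f (X ω) - e (X ω)) ^ 2) P :=
    hbdd ((hfX.sub heX).pow_const 2) fun ω => by
      rw [abs_pow]; exact pow_le_one₀ (abs_nonneg _) (hfe _)
  have hint4 : Integrable (fun ω => (e (X ω) - Y ω) ^ 2) P :=
    hbdd ((heX.sub hY).pow_const 2) fun ω => by
      rw [abs_pow]; exact pow_le_one₀ (abs_nonneg _) (heY _)
  have e1 : ∀ ω, (f (X ω) - Y ω) ^ 2 = ((f (X ω) - e (X ω)) ^ 2 + (e (X ω) - Y ω) ^ 2)
      + 2 * ((f (X ω) - e (X ω)) * e (X ω) - (f (X ω) - e (X ω)) * Y ω) := fun ω => by ring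
  simp only [e1]
  have hint34 : Integrable (fun ω => (f (X ω) - e (X ω)) ^ 2 + (e (X ω) - Y ω) ^ 2) P :=
    hint3.add hint4
  have hint21 : Integrable (fun ω =>
      (f (X ω) - e (X ω)) * e (X ω) - (f (X ω) - e (X ω)) * Y ω) P := hint2.sub hint1
  rw [integral_add hint34 (hint21.const_mul 2), integral_const_mul,
    integral_sub hint2 hint1, hcross, sub_self, mul_zero, add_zero, integral_add hint3 hint4]

lemma sq_integral_le_integral_sq {g : Ω → ℝ} (hg : Integrable g P)
    (hg2 : Integrable (fun ω => g ω ^ 2) P) : (∫ ω, g ω ∂P) ^ 2 ≤ ∫ ω, g ω ^ 2 ∂P := by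
  set m := ∫ ω, g ω ∂P with hm
  have h : 0 ≤ ∫ ω, (g ω - m) ^ 2 ∂P := integral_nonneg fun ω => sq_nonneg _
  have e : ∀ ω, (g ω - m) ^ 2 = g ω ^ 2 - 2 * m * g ω + m ^ 2 := fun ω => by ring
  simp only [e] at h
  have hintegrable : Integrable (fun ω => g ω ^ 2 - 2 * m * g ω) P := hg2.sub (hg.const_mul _)
  rw [integral_add hintegrable (integrable_const _),
    integral_sub hg2 (hg.const_mul _), integral_const_mul, ← hm] at h
  simp only [integral_const, probReal_univ, smul_eq_mul, one_mul] at h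
  linarith [h]

end BiasVariance

/-! ### Size estimates and measurability for the main theorem. -/

lemma le_maxWidth {L : ℕ} (l : ℕ → ℕ) {i : ℕ} (hi : i ≤ L) : l i ≤ maxWidth L l :=
  Finset.le_sup (f := l) (Finset.mem_range.mpr (by omega))

lemma minSize_pos {L : ℕ} (hL : 1 ≤ L) {l : ℕ → ℕ} (hl : ∀ i ≤ L, 1 ≤ l i) : 0 < minSize L l := by
  unfold minSize
  rw [Finset.lt_min'_iff]
  intro y hy
  rcases Finset.mem_insert.mp hy with rfl | hy
  · exact hL
  · obtain ⟨i, hi, rfl⟩ := Finset.mem_image.mp hy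
    exact hl i (Finset.mem_Ico.mp hi).2.le

lemma numParams_le (L : ℕ) (l : ℕ → ℕ) : numParams l L ≤ L * (maxWidth L l + 1) ^ 2 := by
  unfold numParams
  refine (Finset.sum_le_card_nsmul _ _ ((maxWidth L l + 1) ^ 2) fun j hj => ?_).trans (by simp)
  have hj' := Finset.mem_Icc.mp hj
  have h1 := le_maxWidth l hj'.2
  have h2 := le_maxWidth l (show j - 1 ≤ L by omega)
  rw [sq]
  exact Nat.mul_le_mul (by omega) (by omega)

/-- The deviation bound with mesh `⌈4 Λ c √M⌉` is dominated by the square of the claimed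
generalisation error. -/
lemma deviation_le_sq {L M p : ℕ} (hL : 1 ≤ L) (hM : 1 ≤ M) {W c : ℝ} (hW : 2 ≤ W) (hc : 2 ≤ c)
    (hp : (p : ℝ) ≤ L * W ^ 2)
    (hb : c ^ 3 * L * W * Real.log (Real.exp 1 * M) / (M : ℝ) ^ (1 / 4 : ℝ) < 1) :
    2 * (Real.log ((⌈4 * (L * W ^ L * c ^ (L - 1)) * c * √M⌉₊ : ℝ) ^ p
        * (2 * Real.exp (1 / 8))) / √M
      + 4 * (L * W ^ L * c ^ (L - 1) * (c / (⌈4 * (L * W ^ L * c ^ (L - 1)) * c * √M⌉₊ : ℝ))))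
      ≤ (c ^ 3 * L * W * Real.log (Real.exp 1 * M) / (M : ℝ) ^ (1 / 4 : ℝ)) ^ 2 := by
  have hM1 : (1 : ℝ) ≤ M := by exact_mod_cast hM
  have hM0 : (0 : ℝ) < M := by linarith
  have hL1 : (1 : ℝ) ≤ L := by exact_mod_cast hL
  have hs1 : 1 ≤ √(M : ℝ) := Real.one_le_sqrt.mpr hM1
  have hs0 : 0 < √(M : ℝ) := by linarith
  set Λ : ℝ := L * W ^ L * c ^ (L - 1) with hΛ
  have hΛc : Λ * c = L * W ^ L * c ^ L := by
    obtain ⟨k, rfl⟩ : ∃ k, L = k + 1 := ⟨L - 1, by omega⟩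
    rw [hΛ, Nat.add_sub_cancel, pow_succ c k]; ring
  have hΛc1 : 1 ≤ Λ * c := by
    rw [hΛc]
    exact one_le_mul_of_one_le_of_one_le (one_le_mul_of_one_le_of_one_le hL1
      (one_le_pow₀ (by linarith))) (one_le_pow₀ (by linarith))
  set N := ⌈4 * Λ * c * √(M : ℝ)⌉₊ with hN
  have hbase : 1 ≤ Λ * c * √(M : ℝ) := one_le_mul_of_one_le_of_one_le hΛc1 hs1
  have hNge : 4 * Λ * c * √(M : ℝ) ≤ N := Nat.le_ceil _
  have hNle : (N : ℝ) ≤ 5 * (Λ * c * √(M : ℝ)) := by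
    have := Nat.ceil_lt_add_one (show 0 ≤ 4 * Λ * c * √(M : ℝ) by nlinarith)
    rw [← hN] at this
    linarith
  have hNpos : (0 : ℝ) < N := by nlinarith
  set x := Real.log M with hx
  have hx0 : 0 ≤ x := Real.log_nonneg hM1
  have hlog : Real.log (Real.exp 1 * M) = 1 + x := by
    rw [Real.log_mul (Real.exp_pos 1).ne' hM0.ne', Real.log_exp]
  rw [hlog] at hb ⊢
  have hroot : (0 : ℝ) < (M : ℝ) ^ (1 / 4 : ℝ) := by positivity
  -- The assumption that the generalisation term is below `1` yields `c ^ 3 * L * W ≤ M ^ (1 / 4)`.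
  -- Hence the logarithm of the mesh size `N`, which involves `L * log W` and `L * log c`, is at
  -- most of order `L * (1 + log M)`.
  have hlogs : 3 * Real.log c + Real.log L + Real.log W ≤ x / 4 := by
    rw [div_lt_one hroot] at hb
    have h1 : c ^ 3 * L * W ≤ (M : ℝ) ^ (1 / 4 : ℝ) := by
      have : 0 ≤ c ^ 3 * L * W * x := by positivity
      linarith
    have h2 := Real.log_le_log (by positivity) h1
    rw [Real.log_rpow hM0, Real.log_mul (by positivity) (by positivity),
      Real.log_mul (by positivity) (by positivity), Real.log_pow] at h2
    push_cast at h2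
    linarith
  have hlc : 0 ≤ Real.log c := Real.log_nonneg (by linarith)
  have hlL : 0 ≤ Real.log L := Real.log_nonneg hL1
  have hlogN : Real.log N ≤ 4 * L * (1 + x) := by
    have h1 := Real.log_le_log hNpos hNle
    rw [hΛc, Real.log_mul (by norm_num) (by positivity), Real.log_mul (by positivity) (by positivity),
      Real.log_mul (by positivity) (by positivity), Real.log_mul (by positivity) (by positivity),
      Real.log_pow, Real.log_pow, Real.log_sqrt hM0.le, ← hx] at h1
    have h5 : Real.log 5 ≤ 4 := by
      have := Real.log_le_sub_one_of_pos (show (0 : ℝ) < 5 by norm_num)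
      linarith
    have h6 : (L : ℝ) * (3 * Real.log c + Real.log L + Real.log W) ≤ L * (x / 4) := by gcongr
    have h7 : Real.log L ≤ L * Real.log L := le_mul_of_one_le_left hlL hL1
    have h8 : 0 ≤ L * Real.log c := by positivity
    have h9 : x ≤ L * x := le_mul_of_one_le_left hx0 hL1
    linarith
  have hfirst : Real.log ((N : ℝ) ^ p * (2 * Real.exp (1 / 8)))
      ≤ 4 * (L ^ 2 * W ^ 2 * (1 + x)) + 9 / 8 := by
    rw [Real.log_mul (by positivity) (by positivity), Real.log_pow,
      Real.log_mul (by norm_num) (by positivity), Real.log_exp]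
    have h1 : Real.log 2 ≤ 1 := by
      have := Real.log_le_sub_one_of_pos (show (0 : ℝ) < 2 by norm_num)
      linarith
    have h2 : (p : ℝ) * Real.log N ≤ (L * W ^ 2) * (4 * L * (1 + x)) :=
      (mul_le_mul_of_nonneg_left hlogN (Nat.cast_nonneg p)).trans
        (mul_le_mul_of_nonneg_right hp (by positivity))
    linarith
  -- The mesh `N` is chosen so that the discretisation error does not exceed the order of the
  -- statistical error.
  have hsecond : 4 * (Λ * (c / N)) ≤ 1 / √M := by
    rw [le_div_iff₀ hs0]
    calc 4 * (Λ * (c / N)) * √M = (4 * Λ * c * √M) / N := by ring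
      _ ≤ 1 := (div_le_one hNpos).mpr hNge
  have hsq : ((M : ℝ) ^ (1 / 4 : ℝ)) ^ 2 = √M := by
    rw [← Real.rpow_natCast, ← Real.rpow_mul hM0.le, Real.sqrt_eq_rpow]
    norm_num
  rw [div_pow, hsq]
  have hLW : 4 ≤ (L : ℝ) ^ 2 * W ^ 2 := by nlinarith [one_le_pow₀ hL1 (n := 2)]
  set q := (L : ℝ) ^ 2 * W ^ 2 with hq
  have hq1 : q * 1 ≤ q * (1 + x) := by gcongr; linarith
  have hq2 : q * (1 + x) ≤ q * (1 + x) ^ 2 := by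
    gcongr; nlinarith
  have hc6 : (64 : ℝ) ≤ c ^ 6 := by
    calc (64 : ℝ) = 2 ^ 6 := by norm_num
      _ ≤ c ^ 6 := by gcongr
  have hfin : 2 * (4 * (q * (1 + x)) + 9 / 8 + 1) ≤ (c ^ 3 * L * W * (1 + x)) ^ 2 := by
    have e : (c ^ 3 * L * W * (1 + x)) ^ 2 = c ^ 6 * (q * (1 + x) ^ 2) := by rw [hq]; ring
    have h1 : 64 * (q * (1 + x) ^ 2) ≤ c ^ 6 * (q * (1 + x) ^ 2) := by gcongr
    rw [e]; linarith
  calc _ ≤ 2 * ((4 * (q * (1 + x)) + 9 / 8) / √M + 1 / √M) := by gcongr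
    _ = 2 * (4 * (q * (1 + x)) + 9 / 8 + 1) / √M := by ring
    _ ≤ _ := by gcongr

lemma measurable_of_lipschitz_unitCube {d : ℕ} {c : ℝ} (hc : 0 ≤ c) {E : UnitCube d → unitInterval}
    (hE : ∀ x y : UnitCube d,
      |(E x : ℝ) - (E y : ℝ)| ≤ c * ∑ i, |(x : Fin d → ℝ) i - (y : Fin d → ℝ) i|) :
    Measurable fun x => (E x : ℝ) := by
  refine (LipschitzWith.of_dist_le_mul (K := ⟨c * d, by positivity⟩)
    fun x y => ?_).continuous.measurable
  rw [Real.dist_eq]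
  refine (hE x y).trans ?_
  change _ ≤ c * d * dist x y
  rw [mul_assoc]
  gcongr
  refine (Finset.sum_le_card_nsmul _ _ (dist x y) fun i _ => ?_).trans (by simp)
  rw [← Real.dist_eq]
  exact dist_le_pi_dist (x : Fin d → ℝ) (y : Fin d → ℝ) i

/-- The index set is countable, so measurability for each fixed index suffices. -/
lemma measurable_random_index {Ω β : Type*} [MeasurableSpace Ω] [MeasurableSpace β]
    {Θ : ℕ → ℕ → Ω → β} (hΘ : ∀ k n, Measurable (Θ k n)) {kk : Ω → ℕ × ℕ} (hkk : Measurable kk) :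
    Measurable fun ω => Θ (kk ω).1 (kk ω).2 ω :=
  (measurable_from_prod_countable_right (f := fun q : (ℕ × ℕ) × Ω => Θ q.1.1 q.1.2 q.2)
    fun q => hΘ q.1 q.2).comp (hkk.prodMk measurable_id)

lemma measurable_abs_clippedNN_sub {Ω : Type*} [MeasurableSpace Ω] {d D L : ℕ} {l : ℕ → ℕ}
    {hl0 : l 0 = d} {T : Ω → Fin D → ℝ} (hT : Measurable T) {E : UnitCube d → unitInterval}
    (hE : Measurable fun x => (E x : ℝ)) :
    Measurable fun p : Ω × UnitCube d =>
      |clippedNN L l hl0 (T p.1) (p.2 : Fin d → ℝ) - (E p.2 : ℝ)| := by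
  have hpair : Measurable fun p : Ω × UnitCube d => (T p.1, (p.2 : Fin d → ℝ)) :=
    (hT.comp measurable_fst).prodMk (measurable_subtype_coe.comp measurable_snd)
  exact (((continuous_clippedNN L l hl0).measurable.comp hpair).sub (hE.comp measurable_snd)).abs

lemma le_of_sq_le_sq_of_nonneg {x y : ℝ} (h : x ^ 2 ≤ y ^ 2) (hy : 0 ≤ y) : x ≤ y :=
  (abs_le_of_sq_le_sq' h hy).2

/-! ### The full error estimate. -/

/-- Joint measurability is part of the conclusion because a Bochner integral of a non-integrable
function is `0` by convention, so the inequality alone could be void. The norm on `Fin D → ℝ` is the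
maximum norm. -/
theorem theorem1p1
    (d D L J M K N : ℕ) (hd : 1 ≤ d) (hD : 1 ≤ D) (hL : 1 ≤ L) (hJ : 1 ≤ J)
    (hM : 1 ≤ M) (hK : 1 ≤ K) (hN : 1 ≤ N)
    (γ Lip c : ℝ) (hc : max 2 Lip ≤ c)
    (l : ℕ → ℕ) (hl : ∀ i ≤ L, 1 ≤ l i)
    (NN : Finset ℕ) (hNN : ∀ n ∈ NN, n ≤ N) (hNN0 : 0 ∈ NN)
    (hl0 : l 0 = d) (hlL : l L = 1) (hparams : numParams l L ≤ D)
    {Ω : Type*} [MeasurableSpace Ω] (P : Measure Ω) [IsProbabilityMeasure P]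
    -- the samples
    (X : ℕ → ℕ → ℕ → Ω → UnitCube d) (Y : ℕ → ℕ → ℕ → Ω → unitInterval)
    (hXYmeas : ∀ j, 1 ≤ j → Measurable (fun ω => (X 0 0 j ω, Y 0 0 j ω)))
    (hXYindep : iIndepFun (fun (j : ℕ) ω => (X 0 0 (j + 1) ω, Y 0 0 (j + 1) ω)) P)
    (hXYident : ∀ j, 1 ≤ j → IdentDistrib (fun ω => (X 0 0 j ω, Y 0 0 j ω))
      (fun ω => (X 0 0 1 ω, Y 0 0 1 ω)) P P)
    -- the target function
    (E : UnitCube d → unitInterval)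
    (hE : (fun ω => (E (X 0 0 1 ω) : ℝ)) =ᵐ[P]
      P[fun ω => (Y 0 0 1 ω : ℝ) | MeasurableSpace.comap (X 0 0 1) inferInstance])
    (hELip : ∀ x y : UnitCube d,
      |(E x : ℝ) - (E y : ℝ)| ≤ Lip * ∑ i, |(x : Fin d → ℝ) i - (y : Fin d → ℝ) i|)
    -- the random parameter vectors, their initialisation and their training
    (Θ : ℕ → ℕ → Ω → (Fin D → ℝ)) (hΘmeas : ∀ k n, Measurable (Θ k n))
    (kk : Ω → ℕ × ℕ) (hkkmeas : Measurable kk)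
    (hΘrange : ∀ k, 1 ≤ k → ∀ ω, Θ k 0 ω ∈ Set.Icc (fun _ => -c) (fun _ => c))
    (hΘindep : iIndepFun (fun (k : ℕ) => Θ (k + 1) 0) P)
    (hΘident : ∀ k, 1 ≤ k → IdentDistrib (Θ k 0) (Θ 1 0) P P)
    (hΘunif : pdf.IsUniform (Θ 1 0) (Set.Icc (fun _ => -c) (fun _ => c)) P volume)
    (G : ℕ → ℕ → (Fin D → ℝ) → Ω → (Fin D → ℝ))
    (hG : ∀ k n, 1 ≤ k → 1 ≤ n → ∀ ω θ,
      DifferentiableAt ℝ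
        (empiricalRisk L l hl0 (fun j => X k n j ω) (fun j => Y k n j ω) J) θ →
      G k n θ ω =
        grad (empiricalRisk L l hl0 (fun j => X k n j ω) (fun j => Y k n j ω) J) θ)
    (hΘstep : ∀ k n, 1 ≤ k → 1 ≤ n → ∀ ω,
      Θ k n ω = Θ k (n - 1) ω - γ • G k n (Θ k (n - 1) ω) ω)
    -- `kk ω` is a minimiser over `{1, …, K} × NN` subject to `‖Θ_{l,m}(ω)‖_∞ ≤ c`
    (hkk : ∀ ω,
      ((kk ω).1 ∈ Finset.Icc 1 K ∧ (kk ω).2 ∈ NN ∧ ‖Θ (kk ω).1 (kk ω).2 ω‖ ≤ c) ∧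
      ∀ q : ℕ × ℕ, q.1 ∈ Finset.Icc 1 K → q.2 ∈ NN → ‖Θ q.1 q.2 ω‖ ≤ c →
        empiricalRisk L l hl0 (fun j => X 0 0 j ω) (fun j => Y 0 0 j ω) M
            (Θ (kk ω).1 (kk ω).2 ω)
          ≤ empiricalRisk L l hl0 (fun j => X 0 0 j ω) (fun j => Y 0 0 j ω) M
            (Θ q.1 q.2 ω)) :
    -- the left-hand side is well defined: its (bounded) integrand is jointly measurable
    Measurable (fun p : Ω × UnitCube d =>
      |clippedNN L l hl0 (Θ (kk p.1).1 (kk p.1).2 p.1) (p.2 : Fin d → ℝ) - (E p.2 : ℝ)|) ∧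
    ∫ ω, (∫ x : UnitCube d,
        |clippedNN L l hl0 (Θ (kk ω).1 (kk ω).2 ω) (x : Fin d → ℝ) - (E x : ℝ)|
          ∂(P.map (X 0 0 1))) ∂P
      ≤ (d : ℝ) * c ^ 3 / (minSize L l : ℝ) ^ (1 / (d : ℝ))
        + c ^ 3 * (L : ℝ) * ((maxWidth L l : ℝ) + 1) * Real.log (Real.exp 1 * (M : ℝ))
            / (M : ℝ) ^ (1 / 4 : ℝ)
        + (L : ℝ) * ((maxWidth L l : ℝ) + 1) ^ L * c ^ (L + 1)
            / (K : ℝ) ^ ((2 * (L : ℝ))⁻¹ * (((maxWidth L l : ℝ) + 1) ^ 2)⁻¹) := by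
  have hc2 : 2 ≤ c := (le_max_left _ _).trans hc
  have hLipc : Lip ≤ c := (le_max_right _ _).trans hc
  have hELip' : ∀ x y : UnitCube d,
      |(E x : ℝ) - (E y : ℝ)| ≤ c * ∑ i, |(x : Fin d → ℝ) i - (y : Fin d → ℝ) i| := fun x y =>
    (hELip x y).trans (mul_le_mul_of_nonneg_right hLipc (Finset.sum_nonneg fun _ _ => abs_nonneg _))
  have hEm := measurable_of_lipschitz_unitCube (by linarith) hELip'
  have hmeas : Measurable (fun p : Ω × UnitCube d =>
      |clippedNN L l hl0 (Θ (kk p.1).1 (kk p.1).2 p.1) (p.2 : Fin d → ℝ) - (E p.2 : ℝ)|) :=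
    measurable_abs_clippedNN_sub (measurable_random_index hΘmeas hkkmeas) hEm
  refine ⟨hmeas, ?_⟩
  have hX : Measurable (X 0 0 1) := measurable_fst.comp (hXYmeas 1 le_rfl)
  have hY : Measurable (Y 0 0 1) := measurable_snd.comp (hXYmeas 1 le_rfl)
  have : IsProbabilityMeasure (P.map (X 0 0 1)) := Measure.isProbabilityMeasure_map hX.aemeasurable
  have hW2 : (2 : ℝ) ≤ (maxWidth L l : ℝ) + 1 := by
    have : 1 ≤ maxWidth L l := (hl 0 (Nat.zero_le L)).trans (le_maxWidth l (Nat.zero_le L))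
    have : (1 : ℝ) ≤ maxWidth L l := by exact_mod_cast this
    linarith
  have hw : ∀ j < L, (l j : ℝ) ≤ maxWidth L l := fun j hj => by exact_mod_cast le_maxWidth l hj.le
  have hpW : (numParams l L : ℝ) ≤ L * ((maxWidth L l : ℝ) + 1) ^ 2 := by
    exact_mod_cast numParams_le L l
  have hp1 : 1 ≤ numParams l L := by
    obtain ⟨i, rfl⟩ : ∃ i, L = i + 1 := ⟨L - 1, by omega⟩
    rw [numParams_succ, hlL]; omega
  set W : ℝ := (maxWidth L l : ℝ) + 1 with hWdef
  set a : ℝ := (d : ℝ) * c ^ 3 / (minSize L l : ℝ) ^ (1 / (d : ℝ)) with ha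
  set b : ℝ := c ^ 3 * (L : ℝ) * W * Real.log (Real.exp 1 * (M : ℝ)) / (M : ℝ) ^ (1 / 4 : ℝ) with hb
  have hM0 : (0 : ℝ) < M := by exact_mod_cast hM
  have hL0 : (0 : ℝ) < L := by exact_mod_cast hL
  have hK0 : (0 : ℝ) < K := by exact_mod_cast hK
  have ha0 : 0 ≤ a := by positivity
  have hb0 : 0 < b := by
    have : 0 < Real.log (Real.exp 1 * (M : ℝ)) := by
      have : 0 ≤ Real.log M := Real.log_nonneg (by exact_mod_cast hM)
      rw [Real.log_mul (Real.exp_pos 1).ne' hM0.ne', Real.log_exp]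
      linarith
    positivity
  set t : ℝ := (L : ℝ) * W ^ L * c ^ (L + 1) / (K : ℝ) ^ ((2 * (L : ℝ))⁻¹ * (W ^ 2)⁻¹) with ht
  have ht0 : 0 ≤ t := by positivity
  have hdiff : ∀ (θ : Fin D → ℝ) (x : UnitCube d),
      |clippedNN L l hl0 θ (x : Fin d → ℝ) - (E x : ℝ)| ≤ 1 := fun θ x => by
    have h1 := clippedNN_mem L l hl0 θ (x : Fin d → ℝ)
    have h2 := (E x).2
    rw [abs_le]; constructor <;> linarith [h1.1, h1.2, h2.1, h2.2]
  have hdiffm : ∀ θ : Fin D → ℝ,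
      Measurable fun x : UnitCube d => clippedNN L l hl0 θ (x : Fin d → ℝ) - (E x : ℝ) :=
    fun θ => (measurable_clippedNN_unitCube θ).sub hEm
  by_cases hlt : 1 ≤ a + b
  · have hle : ∫ ω, (∫ x : UnitCube d,
        |clippedNN L l hl0 (Θ (kk ω).1 (kk ω).2 ω) (x : Fin d → ℝ) - (E x : ℝ)|
          ∂(P.map (X 0 0 1))) ∂P ≤ 1 := by
      refine (integral_mono_of_nonneg (g := fun _ => (1 : ℝ))
        (Filter.Eventually.of_forall fun ω => integral_nonneg fun x => abs_nonneg _)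
        (integrable_const _) (Filter.Eventually.of_forall fun ω => ?_)).trans (by simp)
      refine (integral_mono_of_nonneg (g := fun _ => (1 : ℝ))
        (Filter.Eventually.of_forall fun x => abs_nonneg _)
        (integrable_const _) (Filter.Eventually.of_forall fun x => hdiff _ x)).trans (by simp)
    linarith
  have ha1 : a < 1 := by linarith
  have hb1 : b < 1 := by linarith
  obtain ⟨θ₀, hθ₀, happrox⟩ := exists_clippedNN_approx hd hl0 hlL hparams hc2 E hELip' ha1
    (minSize_pos hL hl)
  set Λ : ℝ := L * W ^ L * c ^ (L - 1) with hΛ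
  have hΛ0 : 0 < Λ := by positivity
  have hN : 0 < ⌈4 * Λ * c * √(M : ℝ)⌉₊ := Nat.ceil_pos.mpr (by positivity)
  obtain ⟨S, hSint, hSle, hSbound⟩ := exists_uniform_deviation_bound (hl0 := hl0) hL hlL hparams hw
    (by linarith : 1 ≤ c) hXYmeas hXYindep hXYident hM hN
  have hS2 : 2 * ∫ ω, S ω ∂P ≤ b ^ 2 :=
    (mul_le_mul_of_nonneg_left hSbound zero_le_two).trans (deviation_le_sq hL hM hW2 hc2 hpW hb1)
  obtain ⟨V, hVint, hV0, hVclose, hVbound⟩ := exists_closest_initialisation (P := P) hparams hp1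
    (by linarith : 0 < c) hθ₀ (T := fun k => Θ (k + 1) 0) (fun k => hΘmeas _ _)
    (fun k ω i => abs_le.mpr ⟨(hΘrange (k + 1) (by omega) ω).1 i,
      (hΘrange (k + 1) (by omega) ω).2 i⟩)
    hΘindep (fun k => hΘident (k + 1) (by omega)) hΘunif hK
  -- This bound is pointwise in `ω` and linear in `S` and `V`, so only their expectations are needed
  -- afterwards.
  have hpoint : ∀ ω, ∫ x : UnitCube d,
      |clippedNN L l hl0 (Θ (kk ω).1 (kk ω).2 ω) (x : Fin d → ℝ) - (E x : ℝ)| ∂(P.map (X 0 0 1))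
      ≤ (b / 2 + S ω / b) + (a + Λ * (2 * c * V ω)) := by
    intro ω
    obtain ⟨k, hkK, hkV⟩ := hVclose ω
    set θ := Θ (kk ω).1 (kk ω).2 ω
    set θ₁ := Θ (k + 1) 0 ω with hθ₁
    have hθc : ∀ i, |θ i| ≤ c := fun i => (norm_le_pi_norm θ i).trans (hkk ω).1.2.2
    have hθ₁c : ∀ i, |θ₁ i| ≤ c := fun i => abs_le.mpr
      ⟨(hΘrange (k + 1) (by omega) ω).1 i, (hΘrange (k + 1) (by omega) ω).2 i⟩
    -- The initialisation closest to `θ₀` is an admissible competitor, since `0 ∈ NN` and it lies in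
    -- the box.
    have hemp := (hkk ω).2 (k + 1, 0) (Finset.mem_Icc.mpr ⟨by omega, by omega⟩) hNN0
      ((pi_norm_le_iff_of_nonneg (by linarith)).mpr hθ₁c)
    have h1 := (abs_le.mp (hSle ω θ hθc)).1
    have h2 := (abs_le.mp (hSle ω θ₁ hθ₁c)).2
    have hdecomp : ∀ ϑ : Fin D → ℝ, ∫ ω', sqLoss L l hl0 ϑ (X 0 0 1 ω', Y 0 0 1 ω') ∂P
        = ∫ x : UnitCube d, (clippedNN L l hl0 ϑ (x : Fin d → ℝ) - (E x : ℝ)) ^ 2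
            ∂(P.map (X 0 0 1))
          + ∫ ω', ((E (X 0 0 1 ω') : ℝ) - (Y 0 0 1 ω' : ℝ)) ^ 2 ∂P := by
      intro ϑ
      rw [integral_map hX.aemeasurable ((hdiffm ϑ).pow_const 2).aestronglyMeasurable]
      exact integral_sq_sub_eq_add hX (measurable_subtype_coe.comp hY) (fun ω => (Y 0 0 1 ω).2) hEm
        (measurable_clippedNN_unitCube ϑ) (fun x => (E x).2)
        (fun x => clippedNN_mem L l hl0 ϑ (x : Fin d → ℝ)) hE
    have hS0 : 0 ≤ S ω := (abs_nonneg _).trans (hSle ω θ hθc)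
    set u : ℝ := a + Λ * (2 * c * V ω) with hu
    have hVω := hV0 ω
    have hu0 : 0 ≤ u := by positivity
    have hQ₁ : ∫ x : UnitCube d, (clippedNN L l hl0 θ₁ (x : Fin d → ℝ) - (E x : ℝ)) ^ 2
        ∂(P.map (X 0 0 1)) ≤ u ^ 2 := by
      refine (integral_mono_of_nonneg (g := fun _ => u ^ 2)
        (Filter.Eventually.of_forall fun x => sq_nonneg _)
        (integrable_const _) (Filter.Eventually.of_forall fun x => ?_)).trans (by simp)
      refine sq_le_sq' ?_ ?_ <;>
      · have h3 := abs_le.mp (happrox x)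
        have h4 := abs_le.mp (abs_clippedNN_sub_le (θ := θ₁) (θ' := θ₀) hL hl0 hlL hw
          (by linarith : 1 ≤ c) (by positivity : 0 ≤ 2 * c * V ω)
          (fun k _ => abs_param_le (by linarith) hθ₁c k)
          (fun k _ => abs_param_le (by linarith) hθ₀ k) hkV (abs_le_one_of_mem_unitCube x))
        linarith [h3.1, h3.2, h4.1, h4.2]
    have hg : Integrable (fun x : UnitCube d =>
        |clippedNN L l hl0 θ (x : Fin d → ℝ) - (E x : ℝ)|) (P.map (X 0 0 1)) :=
      Integrable.of_mem_Icc 0 1 (hdiffm θ).abs.aemeasurable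
        (Filter.Eventually.of_forall fun x => ⟨abs_nonneg _, hdiff θ x⟩)
    have hg2 : Integrable (fun x : UnitCube d =>
        |clippedNN L l hl0 θ (x : Fin d → ℝ) - (E x : ℝ)| ^ 2) (P.map (X 0 0 1)) :=
      Integrable.of_mem_Icc 0 1 ((hdiffm θ).abs.pow_const 2).aemeasurable
        (Filter.Eventually.of_forall fun x =>
          ⟨sq_nonneg _, pow_le_one₀ (abs_nonneg _) (hdiff θ x)⟩)
    have hjensen := sq_integral_le_integral_sq hg hg2
    simp only [sq_abs] at hjensen
    have hd1 := hdecomp θ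
    have hd2 := hdecomp θ₁
    refine le_of_sq_le_sq_of_nonneg ?_ (by positivity)
    -- The arithmetic-geometric mean inequality bounds `√(2 * S)` by a linear function of `S`; the
    -- weight `b` balances both parts, as `E[S] / b ≤ b / 2`.
    have hr : 2 * S ω ≤ (b / 2 + S ω / b) ^ 2 := by
      have e : (b / 2 + S ω / b) ^ 2 = 2 * S ω + (b / 2 - S ω / b) ^ 2 := by field_simp; ring
      rw [e]; linarith [sq_nonneg (b / 2 - S ω / b)]
    have hr0 : 0 ≤ (b / 2 + S ω / b) * u := by positivity
    calc _ ≤ _ := hjensen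
      _ ≤ 2 * S ω + u ^ 2 := by linarith
      _ ≤ (b / 2 + S ω / b + u) ^ 2 := by
        rw [add_sq (b / 2 + S ω / b) u]; linarith
  -- The number of used parameters is at most `L * W ^ 2`, so the exponent in the claim is weaker by
  -- a spare factor `2`.
  have hKp : (K : ℝ) ^ (-(1 / (numParams l L : ℝ)))
      ≤ ((K : ℝ) ^ ((2 * (L : ℝ))⁻¹ * (W ^ 2)⁻¹))⁻¹ := by
    rw [← Real.rpow_neg hK0.le]
    refine Real.rpow_le_rpow_of_exponent_le (by exact_mod_cast hK) (neg_le_neg ?_)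
    have hp0 : (0 : ℝ) < numParams l L := by exact_mod_cast hp1
    rw [← mul_inv, one_div]
    refine inv_anti₀ hp0 ?_
    have : 0 ≤ L * W ^ 2 := by positivity
    linarith
  have hlast : Λ * (2 * c * ∫ ω, V ω ∂P) ≤ t := by
    have e : c ^ (L + 1) = c ^ 2 * c ^ (L - 1) := by
      rw [← pow_add]; congr 1; omega
    calc Λ * (2 * c * ∫ ω, V ω ∂P)
        ≤ Λ * (c ^ 2 * ((K : ℝ) ^ ((2 * (L : ℝ))⁻¹ * (W ^ 2)⁻¹))⁻¹) := by
          gcongr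
          · exact integral_nonneg hV0
          · nlinarith
          · exact hVbound.trans hKp
      _ = t := by rw [ht, e, hΛ]; ring
  have hint1 : Integrable (fun ω => b / 2 + S ω / b) P :=
    (integrable_const _).add (hSint.div_const b)
  have hint2 : Integrable (fun ω => a + Λ * (2 * c * V ω)) P :=
    (integrable_const _).add ((hVint.const_mul _).const_mul _)
  calc _ ≤ ∫ ω, ((b / 2 + S ω / b) + (a + Λ * (2 * c * V ω))) ∂P :=
        integral_mono_of_nonneg
          (Filter.Eventually.of_forall fun ω => integral_nonneg fun x => abs_nonneg _)
          (hint1.add hint2) (Filter.Eventually.of_forall hpoint)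
    _ = (b / 2 + (∫ ω, S ω ∂P) / b) + (a + Λ * (2 * c * ∫ ω, V ω ∂P)) := by
        rw [integral_add hint1 hint2, integral_add (integrable_const _) (hSint.div_const b),
          integral_add (integrable_const _) ((hVint.const_mul _).const_mul _), integral_div b S,
          integral_const_mul, integral_const_mul]
        simp
    _ ≤ (b / 2 + b / 2) + (a + t) := by
        have : (∫ ω, S ω ∂P) / b ≤ b / 2 := by
          rw [div_le_iff₀ hb0]; linarith
        linarith
    _ = a + b + t := by ring
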